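/- Let $\Gamma$ be a word hyperbolic group whose Gromov boundary $\partial_\infty\Gamma$ properly contains a $2$-sphere, i.e. there is a topological embedding $S^2\to\partial_\infty\Gamma$ that is not surjective. Then for every integer $q\ge 0$ there is no $(2q+1)$-Anosov representation $\rho:\Gamma\to\mathsf{SL}_{4q+2}(\mathbb{C})$. Here, for $1\le k\le d/2$, a homomorphism $\rho:\Gamma\to\mathsf{SL}_d(\mathbb{C})$ is called $k$-Anosov if there exist $c,\mu>0$ such that $$\frac{\sigma_k(\rho(\gamma))}{\sigma_{k+1}(\rho(\gamma))}\ \ge\ c\,e^{\mu|\gamma|_\Gamma}\qquad\text{for all }\gamma\in\Gamma,$$ where $\sigma_1(g)\ge\dots\ge\sigma_d(g)$ are the singular values of $g$ and $|\gamma|_\Gamma$ is the word length of $\gamma$ with respect to a fixed finite generating set of $\Gamma$. -/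

import Mathlib

/-- The left-invariant word metric on `Γ` with respect to `S`: the graph distance in the Cayley
graph, in which `g` is joined to `g * s` for all `s ∈ S`. -/
noncomputable def wordDist {Γ : Type*} [Group Γ] (S : Set Γ) (g h : Γ) : ℕ :=
  (SimpleGraph.mulCayley S).dist g h

/-- The word length `|γ|`: the distance of `γ` from the identity. -/
noncomputable def wordLength {Γ : Type*} [Group Γ] (S : Set Γ) (g : Γ) : ℕ :=
  wordDist S 1 g

/-- The Gromov product `(x | y)_w` in the word metric. -/
noncomputable def gromovProduct {Γ : Type*} [Group Γ] (S : Set Γ) (w x y : Γ) : ℝ :=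
  ((wordDist S w x : ℝ) + wordDist S w y - wordDist S x y) / 2

/-- `Γ` is a word hyperbolic group, as witnessed by the finite generating set `S`: the word metric
of `S` satisfies Gromov's four-point condition for some `δ`. -/
structure IsWordHyperbolic {Γ : Type*} [Group Γ] (S : Set Γ) : Prop where
  finite : S.Finite
  closure_eq_top : Subgroup.closure S = ⊤
  hyperbolic : ∃ δ : ℝ, ∀ w x y z : Γ,
    min (gromovProduct S w x y) (gromovProduct S w y z) - δ ≤ gromovProduct S w x z

/-- Geodesic rays in the Cayley graph of `(Γ, S)` that start at the identity, given by the sequence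
of vertices that they pass at integer times. -/
structure GeodesicRay {Γ : Type*} [Group Γ] (S : Set Γ) where
  toFun : ℕ → Γ
  map_zero : toFun 0 = 1
  dist_eq : ∀ m n : ℕ, wordDist S (toFun m) (toFun (m + n)) = n

/-- The topology of uniform convergence on compact sets. For rays that are given by their vertices
this is pointwise convergence, `Γ` being discrete. -/
instance GeodesicRay.instTopologicalSpace {Γ : Type*} [Group Γ] (S : Set Γ) :
    TopologicalSpace (GeodesicRay S) :=
  TopologicalSpace.induced GeodesicRay.toFun
    (@Pi.topologicalSpace ℕ (fun _ => Γ) (fun _ => ⊥))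

/-- Two rays are asymptotic if they stay at bounded distance from each other. -/
def GeodesicRay.Asymptotic {Γ : Type*} [Group Γ] {S : Set Γ} (r s : GeodesicRay S) : Prop :=
  ∃ C : ℕ, ∀ n : ℕ, wordDist S (r.toFun n) (s.toFun n) ≤ C

theorem GeodesicRay.reachable {Γ : Type*} [Group Γ] {S : Set Γ} (r : GeodesicRay S) (n : ℕ) :
    (SimpleGraph.mulCayley S).Reachable 1 (r.toFun n) := by
  rcases Nat.eq_zero_or_pos n with rfl | hn
  · rw [r.map_zero]
  · have h := r.dist_eq 0 n
    rw [r.map_zero, Nat.zero_add] at h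
    exact SimpleGraph.Reachable.of_dist_ne_zero (by unfold wordDist at h; omega)

theorem GeodesicRay.wordDist_triangle {Γ : Type*} [Group Γ] {S : Set Γ}
    (r s t : GeodesicRay S) (n : ℕ) :
    wordDist S (r.toFun n) (t.toFun n) ≤
      wordDist S (r.toFun n) (s.toFun n) + wordDist S (s.toFun n) (t.toFun n) := by
  obtain ⟨p, hp⟩ := ((r.reachable n).symm.trans (s.reachable n)).exists_walk_length_eq_dist
  obtain ⟨q, hq⟩ := ((s.reachable n).symm.trans (t.reachable n)).exists_walk_length_eq_dist
  unfold wordDist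
  rw [← hp, ← hq, ← SimpleGraph.Walk.length_append]
  exact SimpleGraph.dist_le _

/-- The equivalence relation of being asymptotic. -/
def GeodesicRay.setoid {Γ : Type*} [Group Γ] (S : Set Γ) : Setoid (GeodesicRay S) where
  r := GeodesicRay.Asymptotic
  iseqv :=
    { refl := fun r => ⟨0, fun n => by simp [wordDist]⟩
      symm := fun {r s} ⟨C, h⟩ => ⟨C, fun n => by
        have := h n
        unfold wordDist at this ⊢
        rwa [SimpleGraph.dist_comm]⟩
      trans := fun {r s t} ⟨C, h⟩ ⟨D, k⟩ => ⟨C + D, fun n =>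
        (r.wordDist_triangle s t n).trans (Nat.add_le_add (h n) (k n))⟩ }

/-- The Gromov boundary of `Γ`: asymptotic classes of geodesic rays from the identity. -/
def GromovBoundary {Γ : Type*} [Group Γ] (S : Set Γ) : Type _ :=
  Quotient (GeodesicRay.setoid S)

/-- The topology of the Gromov boundary: the quotient of the topology on the space of rays. -/
instance GromovBoundary.instTopologicalSpace {Γ : Type*} [Group Γ] (S : Set Γ) :
    TopologicalSpace (GromovBoundary S) :=
  inferInstanceAs (TopologicalSpace (Quotient (GeodesicRay.setoid S)))

/-- `X` has a proper subspace homeomorphic to the 2-sphere. -/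
def ProperlyContainsTwoSphere (X : Type*) [TopologicalSpace X] : Prop :=
  ∃ f : Metric.sphere (0 : EuclideanSpace ℝ (Fin 3)) 1 → X,
    Topology.IsEmbedding f ∧ Set.range f ≠ Set.univ

/-- The `i`-th largest singular value `σ_i(g)`, with `i` counted from `1`; Mathlib counts
from `0`. -/
noncomputable def sigma {d : ℕ} (i : ℕ) (g : Matrix (Fin d) (Fin d) ℂ) : ℝ :=
  (Matrix.toEuclideanLin g).singularValues (i - 1)

/-- `ρ : Γ → SL_d(ℂ)` is `k`-Anosov, where `1 ≤ k ≤ d / 2`. -/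
def IsAnosov {Γ : Type*} [Group Γ] (S : Set Γ) {d : ℕ} (k : ℕ)
    (ρ : Γ →* Matrix.SpecialLinearGroup (Fin d) ℂ) : Prop :=
  1 ≤ k ∧ 2 * k ≤ d ∧ ∃ c μ : ℝ, 0 < c ∧ 0 < μ ∧ ∀ γ : Γ,
    c * Real.exp (μ * wordLength S γ) ≤
      sigma k (ρ γ : Matrix (Fin d) (Fin d) ℂ) / sigma (k + 1) (ρ γ : Matrix (Fin d) (Fin d) ℂ)

/-!
Let `k` be odd and `d = 2k`. If `ρ` is `k`-Anosov, then the operators `Λ^k ρ(γ)` are dominated: they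
map everything close to one line, up to an error that is exponentially small in `|γ|`. Along a
geodesic ray these lines converge, and the limits form a continuous family of lines over the Gromov
boundary. The pairing `ω(x, y) = x ∧ y` on `Λ^k ℂ^d` is invariant and alternating, as `k` is odd,
and it does not vanish on the limit lines of two distinct boundary points.

Now let `f` map the sphere to the boundary and miss a point `z`. The functional `ω(v, ·)`, with `v`
on the line of `z`, does not vanish on any line over the sphere, so it trivializes the family of
lines there by a section `p`. The function `x ↦ ω(p(x), p(-x))` on the sphere is odd, so by
Borsuk–Ulam it vanishes somewhere, and transversality gives `f (-x) = f x`.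
-/

section BorsukUlam

open Real

/-- Spherical coordinates on the unit sphere: `θ` is the polar angle, `φ` the azimuth. -/
noncomputable def sphericalPoint (θ φ : ℝ) : Metric.sphere (0 : EuclideanSpace ℝ (Fin 3)) 1 :=
  ⟨!₂[sin θ * cos φ, sin θ * sin φ, cos θ], by
    rw [mem_sphere_zero_iff_norm, EuclideanSpace.norm_eq, Real.sqrt_eq_one]
    simp only [Fin.sum_univ_three, Real.norm_eq_abs, sq_abs]
    simp
    nlinarith [sin_sq_add_cos_sq θ, sin_sq_add_cos_sq φ]⟩

theorem continuous_uncurry_sphericalPoint : Continuous (Function.uncurry sphericalPoint) := by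
  refine Continuous.subtype_mk ((PiLp.continuous_toLp 2 _).comp (continuous_pi fun i => ?_)) _
  fin_cases i <;> simp only [Fin.zero_eta, Fin.mk_one, Fin.reduceFinMk, Matrix.cons_val_zero,
    Matrix.cons_val_one, Matrix.cons_val] <;> fun_prop

theorem sphericalPoint_add_two_pi (θ φ : ℝ) :
    sphericalPoint θ (φ + 2 * π) = sphericalPoint θ φ := by
  simp [sphericalPoint]

theorem sphericalPoint_zero (φ : ℝ) : sphericalPoint 0 φ = sphericalPoint 0 0 := by
  simp [sphericalPoint]

theorem sphericalPoint_pi_div_two_add_pi (φ : ℝ) :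
    sphericalPoint (π / 2) (φ + π) = -sphericalPoint (π / 2) φ := by
  ext i
  fin_cases i <;> simp [sphericalPoint]

theorem eq_of_exp_comp_eq {X : Type*} [TopologicalSpace X] [PreconnectedSpace X]
    {w : X → ℂ} (hw : Continuous w) (h : ∀ x y, Complex.exp (w x) = Complex.exp (w y)) (x y : X) :
    w x = w y :=
  Complex.isCoveringMap_exp.const_of_comp hw (fun x y => Subtype.ext (h x y)) x y

theorem exists_continuous_exp_eq {X : Type*} [TopologicalSpace X]
    [SimplyConnectedSpace X] [LocallyPathConnectedSpace X] {F : X → ℂ} (hF : Continuous F)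
    (h0 : ∀ x, F x ≠ 0) : ∃ g : X → ℂ, Continuous g ∧ ∀ x, Complex.exp (g x) = F x := by
  have : SimplyConnectedSpace (Set.univ : Set X) :=
    (Homeomorph.Set.univ X).toHomotopyEquiv.simplyConnectedSpace
  obtain ⟨g, hg, hgF⟩ := Complex.exists_continuousOn_eqOn_exp_comp (U := Set.univ)
    this isOpen_univ hF.continuousOn (by simpa using h0)
  exact ⟨g, continuousOn_univ.1 hg, fun x => hgF (Set.mem_univ x)⟩

/-- The Borsuk–Ulam theorem in dimension 2. In spherical coordinates a nowhere vanishing `f` has a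
continuous logarithm. Along the equator it changes by the same odd multiple of `π i` over each half
turn, but over a full turn it changes as much as at the pole, namely not at all. -/
theorem exists_eq_zero_of_odd_on_sphere
    {f : Metric.sphere (0 : EuclideanSpace ℝ (Fin 3)) 1 → ℂ} (hf : Continuous f)
    (hodd : ∀ x, f (-x) = -f x) : ∃ x, f x = 0 := by
  by_contra! h
  obtain ⟨g, hg, hgf⟩ := exists_continuous_exp_eq
    (hf.comp continuous_uncurry_sphericalPoint) fun p => h (Function.uncurry sphericalPoint p)
  simp only [Prod.forall, Function.comp_apply, Function.uncurry_apply_pair] at hgf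
  have hpole (φ : ℝ) : g (0, φ) = g (0, 0) :=
    eq_of_exp_comp_eq (w := fun φ : ℝ => g (0, φ)) (by fun_prop)
      (fun a b => by simp only [hgf, sphericalPoint_zero a, sphericalPoint_zero b]) _ _
  have hperiod (θ φ : ℝ) : g (θ, φ + 2 * π) - g (θ, φ) = 0 := by
    rw [eq_of_exp_comp_eq (w := fun p : ℝ × ℝ => g (p.1, p.2 + 2 * π) - g p) (by fun_prop)
      (fun p q => by simp only [Complex.exp_sub, hgf, sphericalPoint_add_two_pi, ne_eq, h,
        not_false_eq_true, div_self]) (θ, φ) (0, 0), hpole, sub_self]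
  have hantipode (φ : ℝ) : Complex.exp (g (π / 2, φ + π) - g (π / 2, φ)) = -1 := by
    rw [Complex.exp_sub, hgf, hgf, sphericalPoint_pi_div_two_add_pi, hodd, neg_div, div_self (h _)]
  have hconst : g (π / 2, 0 + π) - g (π / 2, 0) = g (π / 2, π + π) - g (π / 2, π) :=
    eq_of_exp_comp_eq (w := fun φ : ℝ => g (π / 2, φ + π) - g (π / 2, φ)) (by fun_prop)
      (fun a b => by simp only [hantipode]) 0 π
  have hzero : g (π / 2, 0 + π) - g (π / 2, 0) = 0 := by
    have := hperiod (π / 2) 0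
    rw [two_mul, zero_add] at this
    rw [zero_add] at hconst ⊢
    linear_combination (hconst + this) / 2
  have h1 := hantipode 0
  rw [hzero, Complex.exp_zero] at h1
  norm_num at h1

end BorsukUlam

section WordMetric

variable {Γ : Type*} [Group Γ] {S : Set Γ}

theorem simpleGraph_edist_map_le {V W : Type*} {G : SimpleGraph V} {G' : SimpleGraph W}
    (φ : G →g G') (u v : V) : G'.edist (φ u) (φ v) ≤ G.edist u v :=
  le_iInf fun p => (SimpleGraph.edist_le (p.map φ)).trans_eq (by rw [SimpleGraph.Walk.length_map])

theorem simpleGraph_dist_map_iso {V W : Type*} {G : SimpleGraph V} {G' : SimpleGraph W}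
    (φ : G ≃g G') (u v : V) : G'.dist (φ u) (φ v) = G.dist u v :=
  congrArg ENat.toNat <| (simpleGraph_edist_map_le φ.toHom u v).antisymm <| by
    simpa using simpleGraph_edist_map_le φ.symm.toHom (φ u) (φ v)

theorem wordDist_comm (g h : Γ) : wordDist S g h = wordDist S h g :=
  SimpleGraph.dist_comm

theorem wordDist_mul_left (a g h : Γ) : wordDist S (a * g) (a * h) = wordDist S g h :=
  simpleGraph_dist_map_iso (G := SimpleGraph.mulCayley S) ⟨Equiv.mulLeft a, by simp⟩ g h

theorem wordLength_inv_mul (g h : Γ) : wordLength S (g⁻¹ * h) = wordDist S g h := by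
  rw [wordLength, ← wordDist_mul_left g, mul_one, mul_inv_cancel_left]

theorem wordLength_inv (g : Γ) : wordLength S g⁻¹ = wordLength S g := by
  rw [← mul_one g⁻¹, wordLength_inv_mul, wordDist_comm, wordLength]

theorem mulCayley_connected (h : Subgroup.closure S = ⊤) :
    (SimpleGraph.mulCayley S).Connected := by
  have hstep (a s : Γ) (hs : s ∈ S ∨ s⁻¹ ∈ S) :
      (SimpleGraph.mulCayley S).Reachable a (a * s) := by
    by_cases ha : a = a * s
    · rw [← ha]
    · exact ((SimpleGraph.mulCayley_adj S _ _).2 ⟨ha, by simpa using hs⟩).reachable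
  have hone (g : Γ) : (SimpleGraph.mulCayley S).Reachable 1 g := by
    induction (h ▸ Subgroup.mem_top g : g ∈ Subgroup.closure S) using
      Subgroup.closure_induction_right with
    | one => rfl
    | mul_right x _ s hs ih => exact ih.trans (hstep x s (.inl hs))
    | mul_inv_cancel x _ s hs ih => exact ih.trans (hstep x s⁻¹ (.inr (by simpa using hs)))
  exact ⟨fun g h => (hone g).symm.trans (hone h)⟩

theorem wordDist_triangle (h : Subgroup.closure S = ⊤) (x y z : Γ) :
    wordDist S x z ≤ wordDist S x y + wordDist S y z :=
  (mulCayley_connected h).dist_triangle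

theorem le_pow_wordLength (h : Subgroup.closure S = ⊤) {ν : Γ → ℝ} {K : ℝ} (hK : 0 ≤ K)
    (hone : ν 1 ≤ 1) (hpos : ∀ g, 0 ≤ ν g) (hmul : ∀ a b, ν (a * b) ≤ ν a * ν b)
    (hS : ∀ s, s ∈ S ∨ s⁻¹ ∈ S → ν s ≤ K) (g : Γ) : ν g ≤ K ^ wordLength S g := by
  have hwalk (a b : Γ) (p : (SimpleGraph.mulCayley S).Walk a b) :
      ν (a⁻¹ * b) ≤ K ^ p.length := by
    induction p with
    | nil => simpa using hone
    | @cons a b c hab p ih =>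
      rw [show a⁻¹ * c = (a⁻¹ * b) * (b⁻¹ * c) by group, SimpleGraph.Walk.length_cons, pow_succ']
      have hs : a⁻¹ * b ∈ S ∨ (a⁻¹ * b)⁻¹ ∈ S := by
        simpa using ((SimpleGraph.mulCayley_adj S _ _).1 hab).2
      exact (hmul _ _).trans (mul_le_mul (hS _ hs) ih (hpos _) hK)
  obtain ⟨p, hp⟩ := (mulCayley_connected h).exists_walk_length_eq_dist 1 g
  simpa [hp, wordLength, wordDist] using hwalk 1 g p

/-- An edge path in the Cayley graph whose subpaths of length `n` have endpoints at distance at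
least `n - D`; in particular a quasi-geodesic. -/
structure IsQuasiGeodesic (S : Set Γ) (D : ℕ) (x : ℕ → Γ) : Prop where
  wordDist_succ : ∀ i, wordDist S (x i) (x (i + 1)) = 1
  le_wordDist_add : ∀ i n, n ≤ wordDist S (x i) (x (i + n)) + D

theorem IsQuasiGeodesic.tail {D : ℕ} {x : ℕ → Γ} (hx : IsQuasiGeodesic S D x) :
    IsQuasiGeodesic S D fun n => x (n + 1) where
  wordDist_succ i := hx.wordDist_succ (i + 1)
  le_wordDist_add i n := by simpa only [add_right_comm] using hx.le_wordDist_add (i + 1) n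

namespace GeodesicRay

theorem isQuasiGeodesic (r : GeodesicRay S) : IsQuasiGeodesic S 0 r.toFun where
  wordDist_succ i := r.dist_eq i 1
  le_wordDist_add i n := (r.dist_eq i n).ge

theorem wordDist_eq (r : GeodesicRay S) {m n : ℕ} (h : m ≤ n) :
    wordDist S (r.toFun m) (r.toFun n) = n - m := by
  obtain ⟨k, rfl⟩ := Nat.exists_eq_add_of_le h
  rw [r.dist_eq, Nat.add_sub_cancel_left]

theorem wordDist_one (r : GeodesicRay S) (n : ℕ) : wordDist S 1 (r.toFun n) = n := by
  rw [← r.map_zero, r.wordDist_eq (Nat.zero_le n), Nat.sub_zero]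

theorem gromovProduct_one (r : GeodesicRay S) {t m : ℕ} (h : t ≤ m) :
    gromovProduct S 1 (r.toFun t) (r.toFun m) = t := by
  rw [gromovProduct, r.wordDist_one, r.wordDist_one, r.wordDist_eq h]
  push_cast [h]
  ring

/-- The concatenation of the initial segment of length `n` of `r`, traversed backwards, with the
ray `s`. -/
def concat (r s : GeodesicRay S) (n i : ℕ) : Γ :=
  if i ≤ n then r.toFun (n - i) else s.toFun (i - n)

theorem concat_zero (r s : GeodesicRay S) (n : ℕ) : r.concat s n 0 = r.toFun n := by
  simp [concat]

theorem concat_add (r s : GeodesicRay S) (n i : ℕ) : r.concat s n (n + i) = s.toFun i := by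
  rcases Nat.eq_zero_or_pos i with rfl | hi
  · simp [concat, r.map_zero, s.map_zero]
  · simp [concat, hi.ne']

theorem isQuasiGeodesic_concat {r s : GeodesicRay S} {D : ℕ}
    (h : ∀ m n, m + n ≤ wordDist S (r.toFun m) (s.toFun n) + D) (n : ℕ) :
    IsQuasiGeodesic S D (r.concat s n) where
  wordDist_succ i := by
    rcases lt_or_ge i n with hi | hi
    · rw [concat, concat, if_pos hi.le, if_pos (Nat.succ_le_of_lt hi), wordDist_comm,
        r.wordDist_eq (by omega)]
      omega
    · obtain ⟨j, rfl⟩ := Nat.exists_eq_add_of_le hi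
      rw [add_assoc, r.concat_add, r.concat_add, s.dist_eq]
  le_wordDist_add i t := by
    rcases le_total i n with hi | hi
    · rcases le_total (i + t) n with hit | hit
      · rw [concat, concat, if_pos hi, if_pos hit, wordDist_comm, r.wordDist_eq (by omega)]
        omega
      · obtain ⟨j, hj⟩ := Nat.exists_eq_add_of_le hit
        rw [hj, r.concat_add, concat, if_pos hi]
        have := h (n - i) j
        omega
    · obtain ⟨j, rfl⟩ := Nat.exists_eq_add_of_le hi
      rw [add_assoc, r.concat_add, r.concat_add, s.dist_eq]
      omega

theorem wordDist_le_of_le_gromovProduct {δ : ℝ}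
    (hδ : ∀ w x y z : Γ,
      min (gromovProduct S w x y) (gromovProduct S w y z) - δ ≤ gromovProduct S w x z)
    (r s : GeodesicRay S) {t m n : ℕ} (hm : t ≤ m) (hn : t ≤ n)
    (h : t ≤ gromovProduct S 1 (r.toFun m) (s.toFun n)) :
    wordDist S (r.toFun t) (s.toFun t) ≤ 4 * δ := by
  have hδ0 : 0 ≤ δ := by simpa [gromovProduct, wordDist] using hδ 1 1 1 1
  have hrs : t - δ ≤ gromovProduct S 1 (s.toFun n) (r.toFun t) := by
    have := hδ 1 (r.toFun t) (r.toFun m) (s.toFun n)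
    rw [r.gromovProduct_one hm, min_eq_left h] at this
    rw [gromovProduct] at this ⊢
    rwa [wordDist_comm (s.toFun n) (r.toFun t), add_comm (wordDist S 1 (s.toFun n) : ℝ)]
  have hst := hδ 1 (s.toFun t) (s.toFun n) (r.toFun t)
  rw [s.gromovProduct_one hn] at hst
  have hle : t - 2 * δ ≤ gromovProduct S 1 (s.toFun t) (r.toFun t) := by
    linarith [le_min (sub_le_self (t : ℝ) hδ0) hrs]
  rw [gromovProduct, r.wordDist_one, s.wordDist_one, wordDist_comm] at hle
  linarith

end GeodesicRay

theorem IsWordHyperbolic.exists_isQuasiGeodesic_concat (hS : IsWordHyperbolic S)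
    {r s : GeodesicRay S} (hrs : ¬ r.Asymptotic s) :
    ∃ D : ℕ, ∀ n, IsQuasiGeodesic S D (r.concat s n) := by
  obtain ⟨δ, hδ⟩ := hS.hyperbolic
  suffices ∃ D : ℕ, ∀ m n, m + n ≤ wordDist S (r.toFun m) (s.toFun n) + D from
    this.imp fun D hD => GeodesicRay.isQuasiGeodesic_concat hD
  by_contra! hclose
  refine hrs ⟨⌈4 * δ⌉₊, fun t => ?_⟩
  obtain ⟨m, n, hmn⟩ := hclose (2 * t)
  have hm := wordDist_triangle hS.closure_eq_top 1 (r.toFun m) (s.toFun n)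
  have hn := wordDist_triangle hS.closure_eq_top 1 (s.toFun n) (r.toFun m)
  rw [wordDist_comm (s.toFun n) (r.toFun m)] at hn
  rw [r.wordDist_one, s.wordDist_one] at hm hn
  have hprod : (t : ℝ) ≤ gromovProduct S 1 (r.toFun m) (s.toFun n) := by
    have : (wordDist S (r.toFun m) (s.toFun n) + 2 * t : ℝ) < m + n := by exact_mod_cast hmn
    rw [gromovProduct, r.wordDist_one, s.wordDist_one]
    linarith
  exact_mod_cast (r.wordDist_le_of_le_gromovProduct hδ s (by omega) (by omega) hprod).trans
    (Nat.le_ceil _)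

end WordMetric

section Domination

open Filter Topology InnerProductSpace

variable {𝕜 H F : Type*} [RCLike 𝕜] [NormedAddCommGroup H] [InnerProductSpace 𝕜 H]
  [NormedAddCommGroup F] [NormedSpace 𝕜 F]

variable (𝕜) in
/-- The orthogonal projection to the line spanned by a unit vector `u`. -/
noncomputable def lineProj (u : H) : H →L[𝕜] H :=
  rankOne 𝕜 u u

theorem lineProj_apply (u y : H) : lineProj 𝕜 u y = inner 𝕜 u y • u :=
  rankOne_apply u u y

theorem continuous_lineProj : Continuous (lineProj 𝕜 : H → H →L[𝕜] H) :=
  (ContinuousLinearMap.toSpanSingletonCLE (𝕜 := 𝕜)).continuous.clm_comp (innerSL 𝕜).continuous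

theorem isClosed_image_lineProj_sphere [ProperSpace H] :
    IsClosed (lineProj 𝕜 '' Metric.sphere (0 : H) 1) :=
  ((isCompact_sphere 0 1).image continuous_lineProj).isClosed

theorem lineProj_self {u : H} (hu : ‖u‖ = 1) : lineProj 𝕜 u u = u := by
  rw [lineProj_apply, inner_self_eq_norm_sq_to_K, hu]
  simp

theorem norm_lineProj_apply {u : H} (hu : ‖u‖ = 1) (y : H) :
    ‖lineProj 𝕜 u y‖ = ‖inner 𝕜 u y‖ := by
  rw [lineProj_apply, norm_smul, hu, mul_one]

theorem norm_inner_le_of_norm_eq_one {u : H} (hu : ‖u‖ = 1) (y : H) : ‖inner 𝕜 u y‖ ≤ ‖y‖ := by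
  simpa [hu] using norm_inner_le_norm (𝕜 := 𝕜) u y

theorem norm_sub_lineProj_sq {u : H} (hu : ‖u‖ = 1) (y : H) :
    ‖y - lineProj 𝕜 u y‖ ^ 2 = ‖y‖ ^ 2 - ‖inner 𝕜 u y‖ ^ 2 := by
  rw [@norm_sub_sq 𝕜, norm_lineProj_apply hu, lineProj_apply, inner_smul_right,
    ← inner_conj_symm y u, RCLike.mul_conj]
  norm_cast
  ring

theorem norm_sub_lineProj_comm {u v : H} (hu : ‖u‖ = 1) (hv : ‖v‖ = 1) :
    ‖u - lineProj 𝕜 v u‖ = ‖v - lineProj 𝕜 u v‖ := by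
  rw [← sq_eq_sq₀ (norm_nonneg _) (norm_nonneg _), norm_sub_lineProj_sq hu,
    norm_sub_lineProj_sq hv, norm_inner_symm, hu, hv]

theorem norm_sub_lineProj_le_norm_sub_smul {u : H} (hu : ‖u‖ = 1) (y : H) (c : 𝕜) :
    ‖y - lineProj 𝕜 u y‖ ≤ ‖y - c • u‖ := by
  have hproj : y - c • u - lineProj 𝕜 u (y - c • u) = y - lineProj 𝕜 u y := by
    rw [map_sub, map_smul, lineProj_self hu, sub_sub_sub_cancel_right]
  rw [← hproj, ← sq_le_sq₀ (norm_nonneg _) (norm_nonneg _), norm_sub_lineProj_sq hu]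
  exact sub_le_self _ (sq_nonneg _)

theorem norm_lineProj_sub_lineProj_le {u v : H} (hu : ‖u‖ = 1) (hv : ‖v‖ = 1) :
    ‖lineProj 𝕜 u - lineProj 𝕜 v‖ ≤ 2 * ‖v - lineProj 𝕜 u v‖ := by
  have hsub : lineProj 𝕜 u - lineProj 𝕜 v =
      rankOne 𝕜 u (u - lineProj 𝕜 v u) - rankOne 𝕜 (v - lineProj 𝕜 u v) v := by
    simp only [lineProj, rankOne_apply, map_sub, map_smulₛₗ, inner_conj_symm, sub_apply, smul_apply,
      RingHom.id_apply]
    abel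
  calc ‖lineProj 𝕜 u - lineProj 𝕜 v‖
      ≤ ‖u‖ * ‖u - lineProj 𝕜 v u‖ + ‖v - lineProj 𝕜 u v‖ * ‖v‖ := by
        rw [hsub, ← norm_rankOne (𝕜 := 𝕜), ← norm_rankOne (𝕜 := 𝕜)]
        exact norm_sub_le _ _
    _ = 2 * ‖v - lineProj 𝕜 u v‖ := by
        rw [norm_sub_lineProj_comm hu hv, hu, hv]
        ring

theorem norm_apply_mul_norm_le {u : H} (hu : ‖u‖ = 1) (A : H →L[𝕜] F) (w : H) :
    ‖A u‖ * ‖w‖ ≤ ‖A w‖ + ‖A‖ * ‖w - lineProj 𝕜 u w‖ := by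
  rcases eq_or_ne w 0 with rfl | hw
  · simp
  obtain ⟨z, hz, hwz⟩ : ∃ z : H, ‖z‖ = 1 ∧ w = (‖w‖ : 𝕜) • z :=
    ⟨(‖w‖⁻¹ : 𝕜) • w, norm_smul_inv_norm hw, by
      rw [smul_inv_smul₀ (by simpa using hw)]⟩
  have hunit : ‖A u‖ ≤ ‖A z‖ + ‖A‖ * ‖z - lineProj 𝕜 u z‖ := calc
    ‖A u‖ = ‖A (lineProj 𝕜 z u) + A (u - lineProj 𝕜 z u)‖ := by
      rw [← map_add, add_sub_cancel]
    _ ≤ ‖inner 𝕜 z u‖ * ‖A z‖ + ‖A‖ * ‖u - lineProj 𝕜 z u‖ := by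
      refine (norm_add_le _ _).trans (add_le_add ?_ (A.le_opNorm _))
      rw [lineProj_apply, map_smul, norm_smul]
    _ ≤ ‖A z‖ + ‖A‖ * ‖z - lineProj 𝕜 u z‖ := by
      rw [norm_sub_lineProj_comm hu hz]
      gcongr
      exact mul_le_of_le_one_left (norm_nonneg _)
        (hu ▸ norm_inner_le_of_norm_eq_one hz u)
  calc ‖A u‖ * ‖w‖ ≤ (‖A z‖ + ‖A‖ * ‖z - lineProj 𝕜 u z‖) * ‖w‖ := by gcongr
    _ = ‖A w‖ + ‖A‖ * ‖w - lineProj 𝕜 u w‖ := by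
      rw [hwz, map_smul, map_smul, ← smul_sub, norm_smul, norm_smul, norm_smul, hz]
      ring

/-- `T` expands the line of some vector to the line of the unit vector `u` with factor `‖T‖`, and
maps everything into a neighbourhood of relative size `ε` of that line. For a matrix with singular
values `σ₁ > σ₂ ≥ …` one may take `ε = σ₂ / σ₁`. -/
structure IsDominated (T : H →L[𝕜] H) (u : H) (ε : ℝ) : Prop where
  norm_eq : ‖u‖ = 1
  exists_preimage : ∃ x, T x = u ∧ ‖T‖ * ‖x‖ ≤ 1
  norm_sub_le : ∀ y, ‖T y - lineProj 𝕜 u (T y)‖ ≤ ε * ‖T‖ * ‖y‖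

namespace IsDominated

variable {T : H →L[𝕜] H} {u : H} {ε : ℝ}

theorem norm_pos (h : IsDominated T u ε) : 0 < ‖T‖ := by
  refine norm_pos_iff.2 fun hT => ?_
  obtain ⟨x, hx, -⟩ := h.exists_preimage
  simpa [← hx, hT] using h.norm_eq

theorem nonneg (h : IsDominated T u ε) : 0 ≤ ε := by
  have hu := (norm_nonneg _).trans (h.norm_sub_le u)
  rw [h.norm_eq, mul_one] at hu
  exact nonneg_of_mul_nonneg_left hu h.norm_pos

theorem mono (h : IsDominated T u ε) {η : ℝ} (hη : ε ≤ η) : IsDominated T u η where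
  norm_eq := h.norm_eq
  exists_preimage := h.exists_preimage
  norm_sub_le y := (h.norm_sub_le y).trans (by gcongr)

theorem of_norm_apply_eq {x : H} {s : ℝ} (hs : 0 < s) (hx : x ≠ 0) (hTx : ‖T x‖ = s * ‖x‖)
    (hT : ∀ y, ‖T y‖ ≤ s * ‖y‖) (hgap : ∀ y, ∃ c : 𝕜, ‖T (y - c • x)‖ ≤ ε * s * ‖y‖) :
    IsDominated T ((‖T x‖⁻¹ : 𝕜) • T x) ε := by
  have hx0 : 0 < ‖x‖ := norm_pos_iff.2 hx
  have hTx0 : T x ≠ 0 := norm_pos_iff.1 (by rw [hTx]; positivity)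
  have hnorm : ‖T‖ = s := le_antisymm (T.opNorm_le_bound hs.le hT) <|
    le_of_mul_le_mul_right (hTx ▸ T.le_opNorm x) hx0
  have hunit : ‖(‖T x‖⁻¹ : 𝕜) • T x‖ = 1 := norm_smul_inv_norm hTx0
  refine ⟨hunit, ⟨(‖T x‖⁻¹ : 𝕜) • x, map_smul _ _ _, ?_⟩, fun y => ?_⟩
  · rw [hnorm, norm_smul, norm_inv, RCLike.norm_ofReal, abs_norm, hTx]
    exact le_of_eq (by field_simp)
  · obtain ⟨c, hc⟩ := hgap y
    rw [hnorm]
    refine (norm_sub_lineProj_le_norm_sub_smul hunit _ (c * ‖T x‖)).trans ?_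
    rwa [smul_smul, mul_assoc, mul_inv_cancel₀ (by simpa using hTx0), mul_one, ← map_smul,
      ← map_sub]

theorem of_mul {V V' : H →L[𝕜] H} (hV : ‖V‖ ≤ 1) (hV' : ‖V'‖ ≤ 1) (hVV' : V * V' = 1)
    (h : IsDominated (T * V) u ε) : IsDominated T u ε := by
  have hTV : ‖T * V‖ ≤ ‖T‖ :=
    (norm_mul_le _ _).trans (mul_le_of_le_one_right (norm_nonneg _) hV)
  have hT : T = T * V * V' := by rw [mul_assoc, hVV', mul_one]
  have hnorm : ‖T‖ ≤ ‖T * V‖ := by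
    conv_lhs => rw [hT]
    exact (norm_mul_le _ _).trans (mul_le_of_le_one_right (norm_nonneg _) hV')
  obtain ⟨x, hx, hxle⟩ := h.exists_preimage
  have hε := h.nonneg
  refine ⟨h.norm_eq, ⟨V x, hx, ?_⟩, fun y => ?_⟩
  · exact (mul_le_mul hnorm (V.le_of_opNorm_le hV x) (norm_nonneg _) (norm_nonneg _)).trans
      (by rwa [one_mul])
  · have hy := h.norm_sub_le (V' y)
    rw [← mul_apply_eq_comp, ← hT] at hy
    refine hy.trans ?_
    gcongr
    simpa using V'.le_of_opNorm_le hV' y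

theorem norm_comp_le (h : IsDominated T u ε) (A : H →L[𝕜] F) :
    ‖A ∘L T‖ ≤ ‖T‖ * (‖A u‖ + ‖A‖ * ε) := by
  have hε := h.nonneg
  refine ContinuousLinearMap.opNorm_le_bound _ (by positivity) fun y => ?_
  calc ‖A (T y)‖ = ‖A (lineProj 𝕜 u (T y)) + A (T y - lineProj 𝕜 u (T y))‖ := by
        rw [← map_add, add_sub_cancel]
    _ ≤ ‖T y‖ * ‖A u‖ + ‖A‖ * (ε * ‖T‖ * ‖y‖) := by
        refine (norm_add_le _ _).trans (add_le_add ?_ (A.le_of_opNorm_le_of_le le_rfl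
          (h.norm_sub_le y)))
        rw [lineProj_apply, map_smul, norm_smul]
        gcongr
        exact norm_inner_le_of_norm_eq_one h.norm_eq (T y)
    _ ≤ ‖T‖ * ‖y‖ * ‖A u‖ + ‖A‖ * (ε * ‖T‖ * ‖y‖) := by
        gcongr
        exact T.le_opNorm y
    _ = ‖T‖ * (‖A u‖ + ‖A‖ * ε) * ‖y‖ := by ring

theorem norm_mul_mul_norm_le {A : H →L[𝕜] H} {K η : ℝ} {w : H} (h : IsDominated T u ε)
    (hA : ‖A‖ ≤ K) (hAw : ‖w‖ ≤ K * ‖A w‖) (hw : ‖w - lineProj 𝕜 u w‖ ≤ η * ‖w‖) (hη : 0 ≤ η) :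
    ‖A * T‖ * ‖w‖ ≤ ‖T‖ * ‖A w‖ * (1 + K ^ 2 * (η + ε)) := by
  have hK : 0 ≤ K := (norm_nonneg A).trans hA
  have hε := h.nonneg
  calc ‖A * T‖ * ‖w‖ ≤ ‖T‖ * (‖A u‖ + ‖A‖ * ε) * ‖w‖ := by
        gcongr
        exact h.norm_comp_le A
    _ = ‖T‖ * (‖A u‖ * ‖w‖ + ‖A‖ * (ε * ‖w‖)) := by ring
    _ ≤ ‖T‖ * (‖A w‖ + ‖A‖ * ‖w - lineProj 𝕜 u w‖ + ‖A‖ * (ε * ‖w‖)) := by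
        gcongr
        exact norm_apply_mul_norm_le h.norm_eq A w
    _ ≤ ‖T‖ * (‖A w‖ + K * (η * ‖w‖) + K * (ε * ‖w‖)) := by gcongr
    _ = ‖T‖ * (‖A w‖ + K * (η + ε) * ‖w‖) := by ring
    _ ≤ ‖T‖ * (‖A w‖ + K * (η + ε) * (K * ‖A w‖)) := by gcongr
    _ = ‖T‖ * ‖A w‖ * (1 + K ^ 2 * (η + ε)) := by ring

end IsDominated

end Domination

section UniformDomination

open Filter Topology InnerProductSpace

variable {𝕜 H Γ : Type*} [RCLike 𝕜] [NormedAddCommGroup H] [InnerProductSpace 𝕜 H] [Group Γ]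
  {S : Set Γ} {R : Γ →* (H →L[𝕜] H)} {u : Γ → H} {C θ K : ℝ}

theorem norm_map_mul_le (R : Γ →* (H →L[𝕜] H)) (a b : Γ) : ‖R (a * b)‖ ≤ ‖R a‖ * ‖R b‖ := by
  rw [map_mul]
  exact norm_mul_le _ _

theorem map_mul_apply (R : Γ →* (H →L[𝕜] H)) (a b : Γ) (v : H) : R (a * b) v = R a (R b v) := by
  rw [map_mul, mul_apply_eq_comp]

theorem exists_norm_map_le_pow_wordLength (hS : S.Finite) (hcl : Subgroup.closure S = ⊤)
    (R : Γ →* (H →L[𝕜] H)) : ∃ K : ℝ, 1 ≤ K ∧ ∀ g, ‖R g‖ ≤ K ^ wordLength S g := by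
  obtain ⟨K, hK⟩ := ((hS.union hS.inv).image fun s => ‖R s‖).bddAbove
  refine ⟨max 1 K, le_max_left _ _, le_pow_wordLength hcl (by positivity) ?_
    (fun g => norm_nonneg _) (norm_map_mul_le R)
    fun s hs => le_max_of_le_right (hK ⟨s, by simpa using hs, rfl⟩)⟩
  rw [map_one]
  exact ContinuousLinearMap.norm_id_le

theorem norm_lineProj_sub_lineProj_mul_le {g h : Γ} {ε η : ℝ} (hg : IsDominated (R g) (u g) ε)
    (hgh : IsDominated (R (g * h)) (u (g * h)) η) :
    ‖lineProj 𝕜 (u g) - lineProj 𝕜 (u (g * h))‖ ≤ 2 * (ε * (‖R h‖ * ‖R h⁻¹‖)) := by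
  have hε := hg.nonneg
  obtain ⟨x, hx, hxle⟩ := hgh.exists_preimage
  have hcancel : ‖R g‖ ≤ ‖R (g * h)‖ * ‖R h⁻¹‖ := by
    simpa using norm_map_mul_le R (g * h) h⁻¹
  refine (norm_lineProj_sub_lineProj_le hg.norm_eq hgh.norm_eq).trans ?_
  gcongr
  calc ‖u (g * h) - lineProj 𝕜 (u g) (u (g * h))‖ ≤ ε * ‖R g‖ * ‖R h x‖ := by
        rw [← hx, map_mul_apply]
        exact hg.norm_sub_le (R h x)
    _ ≤ ε * (‖R (g * h)‖ * ‖R h⁻¹‖) * (‖R h‖ * ‖x‖) := by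
        gcongr
        exact (R h).le_opNorm x
    _ = ε * (‖R h‖ * ‖R h⁻¹‖) * (‖R (g * h)‖ * ‖x‖) := by ring
    _ ≤ ε * (‖R h‖ * ‖R h⁻¹‖) := mul_le_of_le_one_right (by positivity) hxle

theorem norm_map_sub_lineProj_le {a g : Γ} {ε η : ℝ} (hg : IsDominated (R g) (u g) ε)
    (hag : IsDominated (R (a * g)) (u (a * g)) η) :
    ‖R a (u g) - lineProj 𝕜 (u (a * g)) (R a (u g))‖ ≤ η * ‖R a‖ := by
  have hη := hag.nonneg
  obtain ⟨x, hx, hxle⟩ := hg.exists_preimage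
  rw [← hx, ← map_mul_apply]
  calc _ ≤ η * ‖R (a * g)‖ * ‖x‖ := hag.norm_sub_le x
    _ ≤ η * (‖R a‖ * ‖R g‖) * ‖x‖ := by
        gcongr
        exact norm_map_mul_le R a g
    _ = η * ‖R a‖ * (‖R g‖ * ‖x‖) := by ring
    _ ≤ η * ‖R a‖ := mul_le_of_le_one_right (by positivity) hxle

variable (𝕜) in
/-- `v` is a limit of its own projections to the lines spanned by the unit vectors `x n`. If these
lines converge, this says that `v` lies on the limit line. -/
def IsLimitVector (x : ℕ → H) (v : H) : Prop :=
  Tendsto (fun n => lineProj 𝕜 (x n) v) atTop (𝓝 v)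

theorem isLimitVector_iff_tendsto_norm_sub {x : ℕ → H} {v : H} :
    IsLimitVector 𝕜 x v ↔ Tendsto (fun n => ‖v - lineProj 𝕜 (x n) v‖) atTop (𝓝 0) := by
  simp_rw [norm_sub_rev v]
  exact tendsto_iff_norm_sub_tendsto_zero

/-- A representation all of whose operators are dominated, with relative errors that decay
exponentially in the word length. The constant `K` bounds the growth of the operator norms. -/
structure IsUniformlyDominated (S : Set Γ) (R : Γ →* (H →L[𝕜] H)) (u : Γ → H) (C θ K : ℝ) :
    Prop where
  theta_pos : 0 < θ
  theta_lt_one : θ < 1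
  isDominated : ∀ g, IsDominated (R g) (u g) (C * θ ^ wordLength S g)
  one_le : 1 ≤ K
  norm_le_pow : ∀ g, ‖R g‖ ≤ K ^ wordLength S g

namespace IsUniformlyDominated

theorem nonneg (h : IsUniformlyDominated S R u C θ K) : 0 ≤ C := by
  simpa [wordLength, wordDist] using (h.isDominated 1).nonneg

theorem norm_le_of_wordLength_eq_one (h : IsUniformlyDominated S R u C θ K) {a : Γ}
    (ha : wordLength S a = 1) : ‖R a‖ ≤ K := by
  simpa [ha] using h.norm_le_pow a

theorem tendsto_error (h : IsUniformlyDominated S R u C θ K) {y : ℕ → Γ}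
    (hy : Tendsto (fun n => wordLength S (y n)) atTop atTop) :
    Tendsto (fun n => C * θ ^ wordLength S (y n)) atTop (𝓝 0) := by
  simpa using ((tendsto_pow_atTop_nhds_zero_of_lt_one h.theta_pos.le h.theta_lt_one).comp
    hy).const_mul C

theorem norm_lineProj_sub_le (h : IsUniformlyDominated S R u C θ K) {n : ℕ} (g k : Γ)
    (hk : wordLength S k ≤ n) :
    ‖lineProj 𝕜 (u g) - lineProj 𝕜 (u (g * k))‖ ≤
      2 * (C * θ ^ wordLength S g * (K ^ n * K ^ n)) := by
  have hC := h.nonneg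
  have hθ := h.theta_pos
  have hbound (a : Γ) (ha : wordLength S a ≤ n) : ‖R a‖ ≤ K ^ n :=
    (h.norm_le_pow a).trans (pow_le_pow_right₀ h.one_le ha)
  refine (norm_lineProj_sub_lineProj_mul_le (h.isDominated g) (h.isDominated (g * k))).trans ?_
  have hK : 0 ≤ K := zero_le_one.trans h.one_le
  gcongr
  · exact hbound k hk
  · exact hbound k⁻¹ (by rwa [wordLength_inv])

theorem isLimitVector_map (h : IsUniformlyDominated S R u C θ K) {a : Γ} {y : ℕ → Γ}
    (hy : Tendsto (fun n => wordLength S (a * y n)) atTop atTop) {v : H}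
    (hv : IsLimitVector 𝕜 (fun n => u (y n)) v) :
    IsLimitVector 𝕜 (fun n => u (a * y n)) (R a v) := by
  rw [isLimitVector_iff_tendsto_norm_sub] at hv ⊢
  refine squeeze_zero (fun n => norm_nonneg _)
    (g := fun n => ‖R a‖ * ‖v - lineProj 𝕜 (u (y n)) v‖ +
      ‖v‖ * (C * θ ^ wordLength S (a * y n) * ‖R a‖)) (fun n => ?_) ?_
  · have hunit := (h.isDominated (a * y n)).norm_eq
    set p := lineProj 𝕜 (u (y n)) v with hp
    calc ‖R a v - lineProj 𝕜 (u (a * y n)) (R a v)‖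
        ≤ ‖R a v - lineProj 𝕜 (u (a * y n)) (R a p)‖ := by
          rw [lineProj_apply _ (R a p)]
          exact norm_sub_lineProj_le_norm_sub_smul hunit _ _
      _ = ‖R a (v - p) + (R a p - lineProj 𝕜 (u (a * y n)) (R a p))‖ := by
          rw [map_sub, sub_add_sub_cancel]
      _ ≤ ‖R a‖ * ‖v - p‖ + ‖v‖ * (C * θ ^ wordLength S (a * y n) * ‖R a‖) := by
          refine (norm_add_le _ _).trans (add_le_add ((R a).le_opNorm _) ?_)
          rw [hp, lineProj_apply, map_smul, map_smul, ← smul_sub, norm_smul]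
          gcongr
          · exact norm_inner_le_of_norm_eq_one (h.isDominated (y n)).norm_eq v
          · exact norm_map_sub_lineProj_le (h.isDominated (y n)) (h.isDominated (a * y n))
  · simpa using (hv.const_mul ‖R a‖).add (((h.tendsto_error hy).mul_const ‖R a‖).const_mul ‖v‖)

end IsUniformlyDominated

theorem IsQuasiGeodesic.tendsto_wordLength {D : ℕ} {x : ℕ → Γ} (hx : IsQuasiGeodesic S D x) :
    Tendsto (fun n => wordLength S ((x 0)⁻¹ * x n)) atTop atTop := by
  refine tendsto_atTop_mono (fun n => ?_) (tendsto_sub_atTop_nat D)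
  have := hx.le_wordDist_add 0 n
  rw [zero_add] at this
  rw [wordLength_inv_mul]
  omega

namespace IsUniformlyDominated

variable {D : ℕ} {x : ℕ → Γ}

theorem isDominated_quasiGeodesic (h : IsUniformlyDominated S R u C θ K)
    (hx : IsQuasiGeodesic S D x) (n : ℕ) :
    IsDominated (R ((x 0)⁻¹ * x n)) (u ((x 0)⁻¹ * x n)) (C / θ ^ D * θ ^ n) := by
  have hC := h.nonneg
  have hθ := h.theta_pos
  refine (h.isDominated _).mono ?_
  rw [wordLength_inv_mul, div_mul_eq_mul_div, mul_div_assoc]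
  gcongr
  rw [le_div_iff₀ (by positivity), ← pow_add]
  exact pow_le_pow_of_le_one hθ.le h.theta_lt_one.le (by simpa using hx.le_wordDist_add 0 n)

theorem dist_lineProj_succ_le (h : IsUniformlyDominated S R u C θ K)
    (hx : IsQuasiGeodesic S D x) (n : ℕ) :
    dist (lineProj 𝕜 (u ((x 0)⁻¹ * x n))) (lineProj 𝕜 (u ((x 0)⁻¹ * x (n + 1)))) ≤
      2 * (C / θ ^ D) * K ^ 2 * θ ^ n := by
  have hε := (h.isDominated_quasiGeodesic hx n).nonneg
  have hK : (0 : ℝ) ≤ K := zero_le_one.trans h.one_le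
  have hlen : wordLength S ((x n)⁻¹ * x (n + 1)) = 1 := by
    rw [wordLength_inv_mul, hx.wordDist_succ]
  have hmul : (x 0)⁻¹ * x (n + 1) = (x 0)⁻¹ * x n * ((x n)⁻¹ * x (n + 1)) := by group
  have hdom := h.isDominated_quasiGeodesic hx (n + 1)
  rw [dist_eq_norm, hmul]
  rw [hmul] at hdom
  calc _ ≤ 2 * (C / θ ^ D * θ ^ n *
          (‖R ((x n)⁻¹ * x (n + 1))‖ * ‖R ((x n)⁻¹ * x (n + 1))⁻¹‖)) :=
        norm_lineProj_sub_lineProj_mul_le (h.isDominated_quasiGeodesic hx n) hdom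
    _ ≤ 2 * (C / θ ^ D * θ ^ n * (K * K)) := by
        gcongr
        · exact h.norm_le_of_wordLength_eq_one hlen
        · exact h.norm_le_of_wordLength_eq_one (by rwa [wordLength_inv])
    _ = 2 * (C / θ ^ D) * K ^ 2 * θ ^ n := by ring

theorem norm_sub_lineProj_le (h : IsUniformlyDominated S R u C θ K) (hx : IsQuasiGeodesic S D x)
    {v : H} (hv : IsLimitVector 𝕜 (fun n => u ((x 0)⁻¹ * x n)) v) (n : ℕ) :
    ‖v - lineProj 𝕜 (u ((x 0)⁻¹ * x n)) v‖ ≤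
      2 * (C / θ ^ D) * K ^ 2 / (1 - θ) * θ ^ n * ‖v‖ := by
  have hgeom (n : ℕ) : dist (lineProj 𝕜 (u ((x 0)⁻¹ * x n)) v)
      (lineProj 𝕜 (u ((x 0)⁻¹ * x (n + 1))) v) ≤ 2 * (C / θ ^ D) * K ^ 2 * ‖v‖ * θ ^ n := by
    rw [dist_eq_norm, ← sub_apply, mul_right_comm]
    exact ContinuousLinearMap.le_of_opNorm_le _
      (by simpa only [dist_eq_norm] using h.dist_lineProj_succ_le hx n) v
  have := dist_le_of_le_geometric_of_tendsto θ _ h.theta_lt_one hgeom hv n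
  rw [dist_comm, dist_eq_norm] at this
  exact this.trans_eq (by ring)

theorem isLimitVector_tail (h : IsUniformlyDominated S R u C θ K) (hx : IsQuasiGeodesic S D x)
    {v : H} (hv : IsLimitVector 𝕜 (fun n => u ((x 0)⁻¹ * x n)) v) :
    IsLimitVector 𝕜 (fun n => u ((x 1)⁻¹ * x (n + 1))) (R ((x 1)⁻¹ * x 0) v) := by
  have hcancel (n : ℕ) : (x 1)⁻¹ * x 0 * ((x 0)⁻¹ * x (n + 1)) = (x 1)⁻¹ * x (n + 1) := by group
  have hlim := h.isLimitVector_map (a := (x 1)⁻¹ * x 0)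
    (by simpa only [hcancel] using hx.tail.tendsto_wordLength)
    (hv.comp (tendsto_add_atTop_nat 1))
  simpa only [hcancel] using hlim

theorem norm_map_mul_norm_map_le (h : IsUniformlyDominated S R u C θ K)
    (hx : IsQuasiGeodesic S D x) {v : H}
    (hv : IsLimitVector 𝕜 (fun n => u ((x 0)⁻¹ * x n)) v) (m : ℕ) :
    ‖R ((x 0)⁻¹ * x (m + 1))‖ * ‖R ((x 1)⁻¹ * x 0) v‖ ≤ ‖R ((x 1)⁻¹ * x (m + 1))‖ * ‖v‖ *
      (1 + K ^ 2 * (2 * (C / θ ^ D) * K ^ 2 / (1 - θ) + C / θ ^ D) * θ ^ m) := by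
  have hC := h.nonneg
  have hθ := h.theta_pos
  have hθ' := sub_pos.2 h.theta_lt_one
  have hlen : wordLength S ((x 0)⁻¹ * x 1) = 1 := by
    rw [wordLength_inv_mul, hx.wordDist_succ]
  have hinv : ((x 0)⁻¹ * x 1)⁻¹ = (x 1)⁻¹ * x 0 := by group
  set w := R ((x 1)⁻¹ * x 0) v with hw
  have hAw : R ((x 0)⁻¹ * x 1) w = v := by
    rw [hw, ← hinv, ← map_mul_apply, mul_inv_cancel, map_one, one_apply_eq_self]
  have hwle : ‖w‖ ≤ K * ‖R ((x 0)⁻¹ * x 1) w‖ := by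
    rw [hAw]
    refine ContinuousLinearMap.le_of_opNorm_le _ (h.norm_le_of_wordLength_eq_one ?_) v
    rw [← hinv, wordLength_inv, hlen]
  have hstep := (h.isDominated_quasiGeodesic hx.tail m).norm_mul_mul_norm_le
    (h.norm_le_of_wordLength_eq_one hlen) hwle
    (h.norm_sub_lineProj_le hx.tail (h.isLimitVector_tail hx hv) m) (by positivity)
  rw [← map_mul, hAw, zero_add,
    show (x 0)⁻¹ * x 1 * ((x 1)⁻¹ * x (m + 1)) = (x 0)⁻¹ * x (m + 1) by group] at hstep
  exact hstep.trans_eq (by ring)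

/-- The limit vector of a quasi-geodesic is contracted almost as strongly as possible when it is
transported along the path: the `l`-th step from the end loses only a factor `1 + O(θ ^ l)`. -/
theorem norm_mul_norm_map_le_prod (h : IsUniformlyDominated S R u C θ K)
    (hx : IsQuasiGeodesic S D x) {v : H}
    (hv : IsLimitVector 𝕜 (fun n => u ((x 0)⁻¹ * x n)) v) (m : ℕ) :
    ‖R ((x 0)⁻¹ * x m)‖ * ‖R ((x m)⁻¹ * x 0) v‖ ≤
      (∏ l ∈ Finset.range m, (1 + K ^ 2 * (2 * (C / θ ^ D) * K ^ 2 / (1 - θ) + C / θ ^ D) *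
        θ ^ l)) * ‖v‖ := by
  have hC := h.nonneg
  have hθ := h.theta_pos
  have hθ' := sub_pos.2 h.theta_lt_one
  set B := K ^ 2 * (2 * (C / θ ^ D) * K ^ 2 / (1 - θ) + C / θ ^ D)
  induction m generalizing x v with
  | zero =>
    simp only [inv_mul_cancel, map_one, one_apply_eq_self, Finset.range_zero, Finset.prod_empty]
    gcongr
    exact ContinuousLinearMap.norm_id_le
  | succ m ih =>
    have hstep := h.norm_map_mul_norm_map_le hx hv m
    have htail := ih hx.tail (h.isLimitVector_tail hx hv)
    set w := R ((x 1)⁻¹ * x 0) v with hw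
    rw [zero_add, hw, ← map_mul_apply,
      show (x (m + 1))⁻¹ * x 1 * ((x 1)⁻¹ * x 0) = (x (m + 1))⁻¹ * x 0 by group, ← hw] at htail
    rcases eq_or_ne w 0 with hw0 | hw0
    · have : v = R ((x 0)⁻¹ * x 1) w := by
        rw [hw, ← map_mul_apply, show (x 0)⁻¹ * x 1 * ((x 1)⁻¹ * x 0) = 1 by group, map_one,
          one_apply_eq_self]
      simp [this, hw0]
    refine le_of_mul_le_mul_right ?_ (norm_pos_iff.2 hw0)
    rw [Finset.prod_range_succ]
    calc _ = ‖R ((x 0)⁻¹ * x (m + 1))‖ * ‖w‖ * ‖R ((x (m + 1))⁻¹ * x 0) v‖ := by ring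
      _ ≤ ‖R ((x 1)⁻¹ * x (m + 1))‖ * ‖v‖ * (1 + B * θ ^ m) *
          ‖R ((x (m + 1))⁻¹ * x 0) v‖ := by gcongr
      _ = ‖R ((x 1)⁻¹ * x (m + 1))‖ * ‖R ((x (m + 1))⁻¹ * x 0) v‖ *
          (‖v‖ * (1 + B * θ ^ m)) := by ring
      _ ≤ (∏ l ∈ Finset.range m, (1 + B * θ ^ l)) * ‖w‖ * (‖v‖ * (1 + B * θ ^ m)) := by gcongr
      _ = _ := by ring

end IsUniformlyDominated

theorem prod_one_add_mul_pow_le {B θ : ℝ} (hB : 0 ≤ B) (h0 : 0 ≤ θ) (hθ : θ < 1) (n : ℕ) :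
    ∏ l ∈ Finset.range n, (1 + B * θ ^ l) ≤ Real.exp (B / (1 - θ)) := by
  calc ∏ l ∈ Finset.range n, (1 + B * θ ^ l) ≤ ∏ l ∈ Finset.range n, Real.exp (B * θ ^ l) := by
        gcongr with l
        rw [add_comm]
        exact Real.add_one_le_exp _
    _ = Real.exp (B * ∑ l ∈ Finset.range n, θ ^ l) := by rw [← Real.exp_sum, Finset.mul_sum]
    _ ≤ Real.exp (B / (1 - θ)) := by
        rw [div_eq_mul_inv, ← tsum_geometric_of_lt_one h0 hθ]
        gcongr
        exact (summable_geometric_of_lt_one h0 hθ).sum_le_tsum _ fun i _ => by positivity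

variable {ω : H →L[𝕜] H →L[𝕜] 𝕜}

theorem norm_le_of_invariant (hω : ∀ g x y, ω (R g x) (R g y) = ω x y) {κ : NNReal}
    (hκ : AntilipschitzWith κ ω) (g : Γ) : ‖R g‖ ≤ κ * ‖ω‖ * ‖R g⁻¹‖ := by
  refine ContinuousLinearMap.opNorm_le_bound _ (by positivity) fun y => ?_
  have hy : ω (R g y) = ω y ∘L R g⁻¹ := by
    ext z
    rw [ContinuousLinearMap.comp_apply, ← hω g y, ← map_mul_apply, mul_inv_cancel, map_one,
      one_apply_eq_self]
  calc ‖R g y‖ ≤ κ * ‖ω y ∘L R g⁻¹‖ := by simpa [hy] using hκ.le_mul_dist (R g y) 0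
    _ ≤ κ * (‖ω‖ * ‖y‖ * ‖R g⁻¹‖) := by
        gcongr
        exact (ContinuousLinearMap.opNorm_comp_le _ _).trans (by gcongr; exact ω.le_opNorm y)
    _ = κ * ‖ω‖ * ‖R g⁻¹‖ * ‖y‖ := by ring

theorem norm_map_inv_apply_le_of_invariant (hω : ∀ g x y, ω (R g x) (R g y) = ω x y)
    {κ : NNReal} (hκ : AntilipschitzWith κ ω) {g : Γ} {ε : ℝ} (hg : IsDominated (R g) (u g) ε)
    (w : H) : ‖R g⁻¹ w‖ ≤ κ * (‖R g‖ * (‖ω w (u g)‖ + ‖ω w‖ * ε)) := by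
  have hw : ω (R g⁻¹ w) = ω w ∘L R g := by
    ext z
    rw [ContinuousLinearMap.comp_apply, ← hω g, ← map_mul_apply, mul_inv_cancel, map_one,
      one_apply_eq_self]
  calc ‖R g⁻¹ w‖ ≤ κ * ‖ω w ∘L R g‖ := by simpa [hw] using hκ.le_mul_dist (R g⁻¹ w) 0
    _ ≤ κ * (‖R g‖ * (‖ω w (u g)‖ + ‖ω w‖ * ε)) := by
        gcongr
        exact hg.norm_comp_le (ω w)

namespace IsUniformlyDominated

theorem exists_norm_mul_norm_map_le (h : IsUniformlyDominated S R u C θ K) (D : ℕ) :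
    ∃ N : ℝ, 0 < N ∧ ∀ x : ℕ → Γ, IsQuasiGeodesic S D x → ∀ v,
      IsLimitVector 𝕜 (fun n => u ((x 0)⁻¹ * x n)) v → ∀ m,
        ‖R ((x 0)⁻¹ * x m)‖ * ‖R ((x m)⁻¹ * x 0) v‖ ≤ N * ‖v‖ := by
  have hC := h.nonneg
  have hθ := h.theta_pos
  have hθ' := sub_pos.2 h.theta_lt_one
  exact ⟨_, Real.exp_pos _, fun x hx v hv m => (h.norm_mul_norm_map_le_prod hx hv m).trans <|
    mul_le_mul_of_nonneg_right (prod_one_add_mul_pow_le (by positivity) hθ.le h.theta_lt_one m)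
      (norm_nonneg v)⟩

theorem exists_norm_map_inv_mul_norm_le (h : IsUniformlyDominated S R u C θ K) {r s : GeodesicRay S}
    {D : ℕ} (hD : ∀ n, IsQuasiGeodesic S D (r.concat s n)) :
    ∃ N : ℝ, 0 < N ∧ ∀ w, IsLimitVector 𝕜 (fun n => u (s.toFun n)) w → ∀ n,
      ‖R (r.toFun n)⁻¹‖ * ‖w‖ ≤ N * ‖R (r.toFun n)⁻¹ w‖ := by
  obtain ⟨N, hN0, hN⟩ := h.exists_norm_mul_norm_map_le D
  refine ⟨N, hN0, fun w hw n => ?_⟩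
  have hlen := (hD n).tendsto_wordLength.comp (tendsto_add_atTop_nat n)
  simp only [Function.comp_def, r.concat_zero, add_comm _ n, r.concat_add] at hlen
  have hlim : IsLimitVector 𝕜 (fun m => u ((r.concat s n 0)⁻¹ * r.concat s n m))
      (R (r.toFun n)⁻¹ w) := by
    refine (tendsto_add_atTop_iff_nat n).1 ?_
    simpa only [IsLimitVector, r.concat_zero, add_comm _ n, r.concat_add] using
      h.isLimitVector_map hlen hw
  have hone : r.concat s n n = 1 := by simpa [s.map_zero] using r.concat_add s n 0
  simpa [hone, r.concat_zero, ← map_mul_apply] using hN _ (hD n) _ hlim n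

theorem apply_ne_zero_of_not_asymptotic (h : IsUniformlyDominated S R u C θ K)
    (hS : IsWordHyperbolic S) (hω : ∀ g x y, ω (R g x) (R g y) = ω x y) {κ : NNReal}
    (hκ : AntilipschitzWith κ ω) {r s : GeodesicRay S} (hrs : ¬ r.Asymptotic s) {v w : H}
    (hv : IsLimitVector 𝕜 (fun n => u (r.toFun n)) v)
    (hw : IsLimitVector 𝕜 (fun n => u (s.toFun n)) w) (hv0 : v ≠ 0) (hw0 : w ≠ 0) :
    ω w v ≠ 0 := by
  intro hωwv
  -- Let `g` be far out on `r`. Then `u g` is close to the line of `v`, so `ω w` almost vanishes on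
  -- it, which makes `R g⁻¹ w` much shorter than `‖R g⁻¹‖ * ‖w‖`. But seen from `g`, the ray `s`
  -- continues a quasi-geodesic, so `R g⁻¹` expands its limit vector `w` almost maximally.
  obtain ⟨D, hD⟩ := hS.exists_isQuasiGeodesic_concat hrs
  obtain ⟨N, hN0, hN⟩ := h.exists_norm_map_inv_mul_norm_le hD
  set M := N * κ * (κ * ‖ω‖)
  have hbound (n : ℕ) : ‖w‖ * ‖v‖ ≤ M * (‖ω w‖ * ‖v - lineProj 𝕜 (u (r.toFun n)) v‖ +
      ‖ω w‖ * (C * θ ^ wordLength S (r.toFun n)) * ‖v‖) := by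
    set g := r.toFun n
    set ε := C * θ ^ wordLength S g
    have hg : IsDominated (R g) (u g) ε := h.isDominated g
    have hε := hg.nonneg
    have hw' : ‖w‖ ≤ M * (‖ω w (u g)‖ + ‖ω w‖ * ε) := by
      refine le_of_mul_le_mul_left ?_ (h.isDominated g⁻¹).norm_pos
      calc ‖R g⁻¹‖ * ‖w‖ ≤ N * ‖R g⁻¹ w‖ := hN w hw n
        _ ≤ N * (κ * (κ * ‖ω‖ * ‖R g⁻¹‖ * (‖ω w (u g)‖ + ‖ω w‖ * ε))) := by
            gcongr
            refine (norm_map_inv_apply_le_of_invariant hω hκ hg w).trans ?_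
            gcongr
            exact norm_le_of_invariant hω hκ g
        _ = ‖R g⁻¹‖ * (M * (‖ω w (u g)‖ + ‖ω w‖ * ε)) := by ring
    have hu := norm_apply_mul_norm_le hg.norm_eq (ω w) v
    rw [hωwv, norm_zero, zero_add] at hu
    calc ‖w‖ * ‖v‖ ≤ M * (‖ω w (u g)‖ + ‖ω w‖ * ε) * ‖v‖ := by gcongr
      _ = M * (‖ω w (u g)‖ * ‖v‖ + ‖ω w‖ * ε * ‖v‖) := by ring
      _ ≤ _ := by gcongr
  have hlen : Tendsto (fun n => wordLength S (r.toFun n)) atTop atTop := by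
    simpa [r.map_zero] using r.isQuasiGeodesic.tendsto_wordLength
  have hzero : ‖w‖ * ‖v‖ ≤ M * (‖ω w‖ * 0 + ‖ω w‖ * 0 * ‖v‖) :=
    ge_of_tendsto' ((((isLimitVector_iff_tendsto_norm_sub.1 hv).const_mul _).add
      (((h.tendsto_error hlen).const_mul _).mul_const _)).const_mul M) hbound
  exact hzero.not_gt (by simpa using mul_pos (norm_pos_iff.2 hw0) (norm_pos_iff.2 hv0))

end IsUniformlyDominated

end UniformDomination

section BoundaryMap

open Filter Topology InnerProductSpace

theorem GeodesicRay.continuous_comp_eval {Γ X : Type*} [Group Γ] {S : Set Γ} [TopologicalSpace X]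
    (f : Γ → X) (n : ℕ) : Continuous fun r : GeodesicRay S => f (r.toFun n) := by
  let : TopologicalSpace Γ := ⊥
  exact continuous_bot.comp ((continuous_apply n).comp continuous_induced_dom)

namespace IsUniformlyDominated

variable {𝕜 H Γ : Type*} [RCLike 𝕜] [NormedAddCommGroup H] [InnerProductSpace 𝕜 H] [Group Γ]
  {S : Set Γ} {R : Γ →* (H →L[𝕜] H)} {u : Γ → H} {C θ K : ℝ}

theorem exists_tendstoUniformly_lineProj [CompleteSpace H]
    (h : IsUniformlyDominated S R u C θ K) :
    ∃ ξ : GeodesicRay S → H →L[𝕜] H,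
      TendstoUniformly (fun n (r : GeodesicRay S) => lineProj 𝕜 (u (r.toFun n))) ξ atTop := by
  have hgeom (r : GeodesicRay S) (n : ℕ) : dist (lineProj 𝕜 (u (r.toFun n)))
      (lineProj 𝕜 (u (r.toFun (n + 1)))) ≤ 2 * C * K ^ 2 * θ ^ n := by
    simpa [r.map_zero] using h.dist_lineProj_succ_le r.isQuasiGeodesic n
  choose ξ hξ using fun r => cauchySeq_tendsto_of_complete
    (cauchySeq_of_le_geometric θ _ h.theta_lt_one (hgeom r))
  refine ⟨ξ, Metric.tendstoUniformly_iff.2 fun e he => ?_⟩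
  have hlim : Tendsto (fun n => 2 * C * K ^ 2 * θ ^ n / (1 - θ)) atTop (𝓝 0) := by
    simpa using ((tendsto_pow_atTop_nhds_zero_of_lt_one h.theta_pos.le
      h.theta_lt_one).const_mul (2 * C * K ^ 2)).div_const (1 - θ)
  filter_upwards [hlim.eventually_lt_const he] with n hn r
  rw [dist_comm]
  exact (dist_le_of_le_geometric_of_tendsto θ _ h.theta_lt_one (hgeom r) (hξ r) n).trans_lt hn

theorem tendsto_lineProj_sub_of_asymptotic (h : IsUniformlyDominated S R u C θ K)
    {r s : GeodesicRay S} (hrs : r.Asymptotic s) :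
    Tendsto (fun n => lineProj 𝕜 (u (r.toFun n)) - lineProj 𝕜 (u (s.toFun n))) atTop (𝓝 0) := by
  obtain ⟨D, hD⟩ := hrs
  have hlen : Tendsto (fun n => wordLength S (r.toFun n)) atTop atTop := by
    simpa [r.map_zero] using r.isQuasiGeodesic.tendsto_wordLength
  refine squeeze_zero_norm (fun n => ?_)
    (by simpa using ((h.tendsto_error hlen).mul_const (K ^ D * K ^ D)).const_mul 2)
  simpa using h.norm_lineProj_sub_le (n := D) (r.toFun n) ((r.toFun n)⁻¹ * s.toFun n)
    (by rw [wordLength_inv_mul]; exact hD n)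

theorem exists_continuous_tendsto_lineProj [CompleteSpace H]
    (h : IsUniformlyDominated S R u C θ K) :
    ∃ ξ : GromovBoundary S → H →L[𝕜] H, Continuous ξ ∧ ∀ r : GeodesicRay S,
      Tendsto (fun n => lineProj 𝕜 (u (r.toFun n))) atTop (𝓝 (ξ (Quotient.mk _ r))) := by
  obtain ⟨ξ, hξ⟩ := h.exists_tendstoUniformly_lineProj
  have hcont : Continuous ξ := hξ.continuous <| Frequently.of_forall fun n =>
    GeodesicRay.continuous_comp_eval (fun g => lineProj 𝕜 (u g)) n
  have hresp (r s : GeodesicRay S) (hrs : r.Asymptotic s) : ξ r = ξ s :=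
    sub_eq_zero.1 <| tendsto_nhds_unique ((hξ.tendsto_at r).sub (hξ.tendsto_at s))
      (h.tendsto_lineProj_sub_of_asymptotic hrs)
  exact ⟨Quotient.lift ξ hresp, hcont.quotient_lift hresp, hξ.tendsto_at⟩

theorem exists_transverse_boundaryMap [ProperSpace H] (h : IsUniformlyDominated S R u C θ K)
    (hS : IsWordHyperbolic S) {ω : H →L[𝕜] H →L[𝕜] 𝕜}
    (hω : ∀ g x y, ω (R g x) (R g y) = ω x y) {κ : NNReal} (hκ : AntilipschitzWith κ ω) :
    ∃ v : GromovBoundary S → H, Continuous (fun x => lineProj 𝕜 (v x)) ∧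
      Pairwise fun x y => ω (v x) (v y) ≠ 0 := by
  obtain ⟨ξ, hcont, hξ⟩ := h.exists_continuous_tendsto_lineProj
  have hline (x : GromovBoundary S) : ∃ v : H, ‖v‖ = 1 ∧ lineProj 𝕜 v = ξ x := by
    obtain ⟨r, rfl⟩ := Quotient.exists_rep x
    simpa using isClosed_image_lineProj_sphere.mem_of_tendsto (hξ r) <| .of_forall fun n =>
      ⟨u (r.toFun n), by simpa using (h.isDominated (r.toFun n)).norm_eq, rfl⟩
  choose v hv hvξ using hline
  have hlimit {r : GeodesicRay S} {x}
      (hx : Tendsto (fun n => lineProj 𝕜 (u (r.toFun n))) atTop (𝓝 (ξ x))) :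
      IsLimitVector 𝕜 (fun n => u (r.toFun n)) (v x) := by
    have := ((ContinuousLinearMap.apply 𝕜 H (v x)).continuous.tendsto _).comp hx
    rwa [ContinuousLinearMap.apply_apply, ← hvξ, lineProj_self (hv x)] at this
  have hne (x : GromovBoundary S) : v x ≠ 0 := norm_ne_zero_iff.1 (by simp [hv x])
  refine ⟨v, by simpa only [hvξ] using hcont, fun x y hxy => ?_⟩
  obtain ⟨s, rfl⟩ := Quotient.exists_rep x
  obtain ⟨r, rfl⟩ := Quotient.exists_rep y
  exact h.apply_ne_zero_of_not_asymptotic hS hω hκ (fun hrs => hxy (Quotient.sound hrs).symm)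
    (hlimit (hξ r)) (hlimit (hξ s)) (hne _) (hne _)

end IsUniformlyDominated

theorem exists_apply_neg_eq_of_transverse_lines {X H : Type*} [TopologicalSpace X]
    [NormedAddCommGroup H] [InnerProductSpace ℂ H] [CompleteSpace H] {v : X → H}
    (hv : Continuous fun x => lineProj ℂ (v x)) {ω : H →L[ℂ] H →L[ℂ] ℂ}
    (hskew : ∀ x y, ω x y = -ω y x) (htrans : Pairwise fun x y => ω (v x) (v y) ≠ 0)
    {f : Metric.sphere (0 : EuclideanSpace ℝ (Fin 3)) 1 → X} (hf : Continuous f)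
    (hrange : Set.range f ≠ Set.univ) : ∃ x, f (-x) = f x := by
  obtain ⟨z, hz⟩ := (Set.ne_univ_iff_exists_notMem _).1 hrange
  -- The functional `ω (v z)` does not vanish on the lines over the sphere, so the projections of
  -- its Riesz representative form a nowhere vanishing section.
  set t := (toDual ℂ H).symm (ω (v z)) with ht
  have hinner (x) : inner ℂ (v (f x)) t ≠ 0 := by
    rw [← inner_conj_symm, map_ne_zero, ht, toDual_symm_apply]
    exact htrans fun h => hz ⟨x, h.symm⟩
  let p x := lineProj ℂ (v (f x)) t
  have hp : Continuous p := (hv.comp hf).clm_apply continuous_const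
  obtain ⟨x, hx⟩ := exists_eq_zero_of_odd_on_sphere (f := fun x => ω (p x) (p (-x)))
    ((ω.continuous.comp hp).clm_apply (hp.comp continuous_neg))
    (fun x => by rw [neg_neg]; exact hskew _ _)
  refine ⟨x, by_contra fun h => htrans (Ne.symm h) ?_⟩
  simpa [p, lineProj_apply, hinner] using hx

end BoundaryMap

section AntisymmetricTensors

open Equiv Equiv.Perm

variable {𝕜 n : Type*} {k : ℕ}

/-- The `k`-th tensor power of a square matrix, with rows and columns indexed by multi-indices. -/
def tensorPow {R : Type*} [CommSemiring R] (k : ℕ) (g : Matrix n n R) :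
    Matrix (Fin k → n) (Fin k → n) R :=
  Matrix.of fun i j => ∏ a, g (i a) (j a)

section TensorPow

variable {R : Type*} [CommSemiring R]

theorem tensorPow_apply (g : Matrix n n R) (i j : Fin k → n) :
    tensorPow k g i j = ∏ a, g (i a) (j a) := rfl

theorem tensorPow_mul [Fintype n] (g h : Matrix n n R) :
    tensorPow k (g * h) = tensorPow k g * tensorPow k h := by
  ext i j
  simp only [tensorPow_apply, Matrix.mul_apply, Finset.prod_univ_sum, Fintype.piFinset_univ,
    Finset.prod_mul_distrib]

theorem tensorPow_diagonal [DecidableEq n] (s : n → R) :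
    tensorPow k (Matrix.diagonal s) = Matrix.diagonal fun i : Fin k → n => ∏ a, s (i a) := by
  ext i j
  rw [tensorPow_apply]
  rcases eq_or_ne i j with rfl | h
  · simp
  · obtain ⟨a, ha⟩ := Function.ne_iff.1 h
    rw [Matrix.diagonal_apply_ne _ h]
    exact Finset.prod_eq_zero (Finset.mem_univ a) (Matrix.diagonal_apply_ne _ ha)

theorem tensorPow_one [DecidableEq n] : tensorPow k (1 : Matrix n n R) = 1 := by
  rw [← Matrix.diagonal_one, tensorPow_diagonal]
  simp

theorem tensorPow_conjTranspose [StarRing R] (g : Matrix n n R) :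
    tensorPow k g.conjTranspose = (tensorPow k g).conjTranspose := by
  ext i j
  simp only [tensorPow_apply, Matrix.conjTranspose_apply, star_prod]

end TensorPow

variable [RCLike 𝕜] [Fintype n]

/-- The space of antisymmetric `k`-tensors, a model of the `k`-th exterior power of `𝕜ⁿ` that
inherits an inner product from the tensor power. -/
def antisymTensor (𝕜 : Type*) [RCLike 𝕜] (k : ℕ) (n : Type*) [Fintype n] :
    Submodule 𝕜 (EuclideanSpace 𝕜 (Fin k → n)) where
  carrier := {x | ∀ (τ : Perm (Fin k)) (i : Fin k → n), x (i ∘ τ) = (sign τ : ℤ) * x i}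
  add_mem' hx hy τ i := by simp only [PiLp.add_apply, hx τ i, hy τ i, mul_add]
  zero_mem' τ i := by simp
  smul_mem' c x hx τ i := by simp only [PiLp.smul_apply, hx τ i, smul_eq_mul, mul_left_comm]

theorem antisymTensor_apply_comp (x : antisymTensor 𝕜 k n) (τ : Perm (Fin k)) (i : Fin k → n) :
    x.1 (i ∘ τ) = (sign τ : ℤ) * x.1 i :=
  x.2 τ i

theorem antisymTensor_apply_eq_zero (x : antisymTensor 𝕜 k n) {i : Fin k → n}
    (hi : ¬ Function.Injective i) : x.1 i = 0 := by
  obtain ⟨a, b, hab, hne⟩ := Function.not_injective_iff.1 hi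
  have hswap : i ∘ swap a b = i := by
    rw [Equiv.comp_swap_eq_update, hab, Function.update_eq_self, ← hab, Function.update_eq_self]
  have h := antisymTensor_apply_comp x (swap a b) i
  rw [hswap, sign_swap hne] at h
  exact self_eq_neg.1 (by simpa using h)

section Action

variable [DecidableEq n]

theorem toEuclideanCLM_tensorPow_mem (g : Matrix n n 𝕜) (x : antisymTensor 𝕜 k n) :
    Matrix.toEuclideanCLM (𝕜 := 𝕜) (tensorPow k g) x.1 ∈ antisymTensor 𝕜 k n := by
  intro τ i
  simp only [Matrix.ofLp_toEuclideanCLM, Matrix.mulVec, dotProduct, tensorPow_apply]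
  rw [← Equiv.sum_comp (τ.symm.arrowCongr (Equiv.refl n)), Finset.mul_sum]
  refine Finset.sum_congr rfl fun j _ => ?_
  have hj : τ.symm.arrowCongr (Equiv.refl n) j = j ∘ τ := rfl
  rw [hj, antisymTensor_apply_comp]
  simp only [Function.comp]
  rw [Equiv.prod_comp τ fun a => g (i a) (j a)]
  ring

/-- The action of a matrix on antisymmetric tensors, i.e. its `k`-th exterior power. -/
noncomputable def antisymAction (k : ℕ) (g : Matrix n n 𝕜) :
    antisymTensor 𝕜 k n →L[𝕜] antisymTensor 𝕜 k n :=
  ((Matrix.toEuclideanCLM (𝕜 := 𝕜) (tensorPow k g)).comp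
    (antisymTensor 𝕜 k n).subtypeL).codRestrict (antisymTensor 𝕜 k n)
      (toEuclideanCLM_tensorPow_mem g)

theorem coe_antisymAction (g : Matrix n n 𝕜) (x : antisymTensor 𝕜 k n) :
    (antisymAction k g x).1 = Matrix.toEuclideanCLM (𝕜 := 𝕜) (tensorPow k g) x.1 := rfl

theorem antisymAction_mul (g h : Matrix n n 𝕜) :
    antisymAction k (g * h) = antisymAction k g * antisymAction k h := by
  ext1 x
  apply Subtype.ext
  rw [mul_apply_eq_comp, coe_antisymAction, coe_antisymAction, coe_antisymAction, tensorPow_mul,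
    map_mul, mul_apply_eq_comp]

theorem antisymAction_one : antisymAction k (1 : Matrix n n 𝕜) = 1 := by
  ext1 x
  apply Subtype.ext
  rw [coe_antisymAction, tensorPow_one, map_one, one_apply_eq_self, one_apply_eq_self]

/-- The antisymmetrization of the basis tensor with multi-index `i₀`. -/
def antisymSingle (i₀ : Fin k → n) : antisymTensor 𝕜 k n where
  val := WithLp.toLp 2 fun i => ∑ τ : Perm (Fin k), if i = i₀ ∘ τ then ((sign τ : ℤ) : 𝕜) else 0
  property τ i := by
    dsimp only
    rw [← Equiv.sum_comp (Equiv.mulRight τ), Finset.mul_sum]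
    refine Finset.sum_congr rfl fun ρ _ => ?_
    have h : i ∘ τ = i₀ ∘ (ρ * τ : Perm (Fin k)) ↔ i = i₀ ∘ ρ := by
      rw [coe_mul, ← Function.comp_assoc]
      exact τ.surjective.injective_comp_right.eq_iff
    rw [Equiv.coe_mulRight, Perm.sign_mul, mul_ite, mul_zero, Units.val_mul, Int.cast_mul,
      mul_comm]
    simp only [h]

theorem antisymSingle_apply (i₀ i : Fin k → n) : (antisymSingle (𝕜 := 𝕜) i₀).1 i =
    ∑ τ : Perm (Fin k), if i = i₀ ∘ τ then ((sign τ : ℤ) : 𝕜) else 0 := rfl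

theorem antisymSingle_apply_self {i₀ : Fin k → n} (hi : Function.Injective i₀) :
    (antisymSingle (𝕜 := 𝕜) i₀).1 i₀ = 1 := by
  rw [antisymSingle_apply, Finset.sum_eq_single 1 _ (by simp)]
  · simp
  · exact fun τ _ hτ => if_neg fun h => hτ (DFunLike.coe_injective (hi.comp_left h)).symm

theorem antisymSingle_apply_eq_zero {i₀ i : Fin k → n} (h : ∀ τ : Perm (Fin k), i ≠ i₀ ∘ τ) :
    (antisymSingle (𝕜 := 𝕜) i₀).1 i = 0 := by
  rw [antisymSingle_apply]
  exact Finset.sum_eq_zero fun τ _ => if_neg (h τ)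

end Action

end AntisymmetricTensors

section WedgeForm

open Equiv Equiv.Perm Matrix

variable {R n : Type*} [CommRing R] {k : ℕ}

/-- The exterior product of two `k`-tensors in dimension `2k`, read off in the volume form of the
basis ordered by `e`. On antisymmetric tensors it is `(k!)²` times the usual wedge product. -/
def wedgeForm (e : Fin k ⊕ Fin k ≃ n) :
    ((Fin k → n) → R) →ₗ[R] ((Fin k → n) → R) →ₗ[R] R :=
  ∑ π : Perm (Fin k ⊕ Fin k), ((sign π : ℤ) : R) •
    (LinearMap.mul R R).compl₁₂ (LinearMap.proj (e ∘ π ∘ Sum.inl))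
      (LinearMap.proj (e ∘ π ∘ Sum.inr))

theorem wedgeForm_apply (e : Fin k ⊕ Fin k ≃ n) (x y : (Fin k → n) → R) :
    wedgeForm e x y = ∑ π : Perm (Fin k ⊕ Fin k),
      ((sign π : ℤ) : R) * (x (e ∘ π ∘ Sum.inl) * y (e ∘ π ∘ Sum.inr)) := by
  simp [wedgeForm]

theorem wedgeForm_tensorPow_mulVec_eq_sum [Fintype n] (e : Fin k ⊕ Fin k ≃ n) (g : Matrix n n R)
    (x y : (Fin k → n) → R) :
    wedgeForm e (tensorPow k g *ᵥ x) (tensorPow k g *ᵥ y) =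
      ∑ i, ∑ j, x i * y j * (g.submatrix e (Sum.elim i j)).det := by
  simp only [wedgeForm_apply, Matrix.mulVec, dotProduct, Matrix.det_apply', tensorPow_apply,
    Finset.mul_sum, Finset.sum_mul]
  rw [Finset.sum_comm]
  conv_lhs => enter [2, j]; rw [Finset.sum_comm]
  rw [Finset.sum_comm]
  refine Finset.sum_congr rfl fun i _ => Finset.sum_congr rfl fun j _ =>
    Finset.sum_congr rfl fun π _ => ?_
  simp only [Function.comp, Fintype.prod_sum_type, Matrix.submatrix_apply, Sum.elim_inl,
    Sum.elim_inr]
  ring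

theorem wedgeForm_tensorPow_mulVec [Fintype n] [DecidableEq n] (e : Fin k ⊕ Fin k ≃ n)
    (g : Matrix n n R) (x y : (Fin k → n) → R) :
    wedgeForm e (tensorPow k g *ᵥ x) (tensorPow k g *ᵥ y) = g.det * wedgeForm e x y := by
  have hone := wedgeForm_tensorPow_mulVec_eq_sum e 1 x y
  rw [tensorPow_one, Matrix.one_mulVec, Matrix.one_mulVec] at hone
  have hdet (i j : Fin k → n) : (g.submatrix e (Sum.elim i j)).det =
      g.det * ((1 : Matrix n n R).submatrix e (Sum.elim i j)).det := by
    rw [← Matrix.det_submatrix_equiv_self e g, ← Matrix.det_mul, Matrix.submatrix_mul_equiv,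
      mul_one]
  simp only [wedgeForm_tensorPow_mulVec_eq_sum, hone, hdet, Finset.mul_sum, mul_left_comm]

theorem sign_sumComm (k : ℕ) : sign (Equiv.sumComm (Fin k) (Fin k)) = (-1) ^ k := by
  let f : Fin k ⊕ Fin k ≃ Fin k × Bool := (Equiv.boolProdEquivSum (Fin k)).symm.trans
    (Equiv.prodComm Bool (Fin k))
  have : f.permCongr (Equiv.sumComm (Fin k) (Fin k)) = prodCongrRight fun _ => swap false true := by
    ext1 ⟨a, c⟩
    cases c <;> rfl
  rw [← sign_permCongr f, this, sign_prodCongrRight]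
  simp

theorem wedgeForm_comm (e : Fin k ⊕ Fin k ≃ n) (x y : (Fin k → n) → R) :
    wedgeForm e x y = (-1) ^ k * wedgeForm e y x := by
  rw [wedgeForm_apply, wedgeForm_apply, Finset.mul_sum,
    ← Equiv.sum_comp (Equiv.mulRight (Equiv.sumComm (Fin k) (Fin k)))]
  refine Finset.sum_congr rfl fun π _ => ?_
  have hinl : ⇑(π * Equiv.sumComm (Fin k) (Fin k)) ∘ Sum.inl = π ∘ Sum.inr := rfl
  have hinr : ⇑(π * Equiv.sumComm (Fin k) (Fin k)) ∘ Sum.inr = π ∘ Sum.inl := rfl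
  rw [Equiv.coe_mulRight, hinl, hinr, Perm.sign_mul, sign_sumComm]
  push_cast
  ring

theorem exists_perm_comp_inl {i : Fin k → n} (hi : Function.Injective i)
    (e : Fin k ⊕ Fin k ≃ n) : ∃ π : Perm (Fin k ⊕ Fin k), e ∘ π ∘ Sum.inl = i := by
  obtain ⟨π, hπ⟩ := Equiv.Perm.exists_extending_pair (Sum.inl : Fin k → Fin k ⊕ Fin k)
    (e.symm ∘ i) Sum.inl_injective (e.symm.injective.comp hi)
  exact ⟨π, funext fun a => (Equiv.eq_symm_apply e).1 (hπ a)⟩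

theorem exists_eq_mul_sumCongr {α β : Type*} [Finite α] [Finite β] {π π₀ : Perm (α ⊕ β)}
    {τ : Perm α} (h : π ∘ Sum.inl = π₀ ∘ Sum.inl ∘ τ) :
    ∃ τ' : Perm β, π = π₀ * Perm.sumCongr τ τ' := by
  have hinl (a : α) : (π₀⁻¹ * π) (Sum.inl a) = Sum.inl (τ a) :=
    (Equiv.symm_apply_eq π₀).2 (congrFun h a)
  obtain ⟨⟨τ₁, τ'⟩, hτ⟩ := mem_sumCongrHom_range_of_perm_mapsTo_inl (σ := π₀⁻¹ * π)
    (by rintro _ ⟨a, rfl⟩; exact ⟨τ a, (hinl a).symm⟩)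
  obtain rfl : τ₁ = τ := by
    ext1 a
    simpa [← hτ, sumCongrHom] using hinl a
  exact ⟨τ', (eq_inv_mul_iff_mul_eq.1 hτ).symm⟩

open scoped Nat in
theorem wedgeForm_antisymSingle {𝕜 : Type*} [RCLike 𝕜] [Fintype n] [DecidableEq n]
    (e : Fin k ⊕ Fin k ≃ n) (π₀ : Perm (Fin k ⊕ Fin k)) (y : antisymTensor 𝕜 k n) :
    wedgeForm e (antisymSingle (e ∘ π₀ ∘ Sum.inl)).1.ofLp y.1.ofLp =
      (k ! * k ! : ℕ) * ((sign π₀ : ℤ) * y.1 (e ∘ π₀ ∘ Sum.inr)) := by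
  -- The permutations that contribute are those in the coset of `π₀` under `Perm × Perm`.
  let g (p : Perm (Fin k) × Perm (Fin k)) := (π₀ * Perm.sumCongr p.1 p.2, p.1)
  have hg : Function.Injective g := fun p q h =>
    Perm.sumCongrHom_injective (mul_left_cancel (congrArg Prod.fst h))
  have hterm (p : Perm (Fin k) × Perm (Fin k)) : ((sign π₀ : ℤ) : 𝕜) * y.1 (e ∘ π₀ ∘ Sum.inr) =
      (sign (g p).1 : ℤ) * ((sign (g p).2 : ℤ) * y.1 (e ∘ (g p).1 ∘ Sum.inr)) := by
    have hinr : e ∘ (g p).1 ∘ Sum.inr = (e ∘ π₀ ∘ Sum.inr) ∘ p.2 := rfl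
    have hsq (τ : Perm (Fin k)) : ((sign τ : ℤ) : 𝕜) * (sign τ : ℤ) = 1 := by
      rw [← Int.cast_mul, Int.units_coe_mul_self, Int.cast_one]
    rw [hinr, antisymTensor_apply_comp, Perm.sign_mul, sign_sumCongr]
    push_cast
    linear_combination (-(sign π₀ : ℤ) * y.1 (e ∘ π₀ ∘ Sum.inr)) *
      (hsq p.1 + (sign p.1 : ℤ) ^ 2 * hsq p.2)
  calc wedgeForm e (antisymSingle (e ∘ π₀ ∘ Sum.inl)).1.ofLp y.1.ofLp
      = ∑ q : Perm (Fin k ⊕ Fin k) × Perm (Fin k), if q.1 ∘ Sum.inl = π₀ ∘ Sum.inl ∘ q.2 then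
          (sign q.1 : ℤ) * ((sign q.2 : ℤ) * y.1 (e ∘ q.1 ∘ Sum.inr)) else 0 := by
        simp only [wedgeForm_apply, antisymSingle_apply, Fintype.sum_prod_type, Finset.sum_mul,
          Finset.mul_sum, ite_mul, zero_mul, mul_ite, mul_zero, Function.comp_assoc,
          e.injective.comp_left.eq_iff]
    _ = ∑ _p : Perm (Fin k) × Perm (Fin k), (sign π₀ : ℤ) * y.1 (e ∘ π₀ ∘ Sum.inr) := by
        symm
        refine Finset.sum_of_injOn g hg.injOn (by simp) (fun q _ hq => if_neg fun h => hq ?_)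
          fun _ _ => ?_
        · obtain ⟨τ', hτ'⟩ := exists_eq_mul_sumCongr h
          exact ⟨(q.2, τ'), by simp, Prod.ext hτ'.symm rfl⟩
        · rw [if_pos, hterm]
          rfl
    _ = _ := by
        rw [Finset.sum_const, nsmul_eq_mul, Finset.card_univ, Fintype.card_prod,
          Fintype.card_perm, Fintype.card_fin]

variable {𝕜 : Type*} [RCLike 𝕜] [Fintype n]

theorem exists_wedgeForm_ne_zero (e : Fin k ⊕ Fin k ≃ n) {y : antisymTensor 𝕜 k n} (hy : y ≠ 0) :
    ∃ x : antisymTensor 𝕜 k n, wedgeForm e x.1.ofLp y.1.ofLp ≠ 0 := by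
  classical
  obtain ⟨j, hj⟩ : ∃ j, y.1 j ≠ 0 := by
    contrapose! hy
    ext j
    exact hy j
  have hinj : Function.Injective j := not_imp_comm.1 (antisymTensor_apply_eq_zero y) hj
  obtain ⟨π, hπ⟩ := exists_perm_comp_inl hinj e
  have hinr : e ∘ ⇑(π * Equiv.sumComm (Fin k) (Fin k)) ∘ Sum.inr = j := hπ
  refine ⟨antisymSingle (e ∘ ⇑(π * Equiv.sumComm (Fin k) (Fin k)) ∘ Sum.inl), ?_⟩
  rw [wedgeForm_antisymSingle, hinr]
  simp [hj, Nat.factorial_ne_zero]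

/-- The exterior product of antisymmetric tensors in middle degree as a continuous bilinear
form. -/
noncomputable def antisymForm (e : Fin k ⊕ Fin k ≃ n) :
    antisymTensor 𝕜 k n →L[𝕜] antisymTensor 𝕜 k n →L[𝕜] 𝕜 :=
  let coords := (WithLp.linearEquiv 2 𝕜 ((Fin k → n) → 𝕜)).toLinearMap ∘ₗ
    (antisymTensor 𝕜 k n).subtype
  ((wedgeForm e).compl₁₂ coords coords).toContinuousBilinearMap

theorem antisymForm_apply (e : Fin k ⊕ Fin k ≃ n) (x y : antisymTensor 𝕜 k n) :
    antisymForm e x y = wedgeForm e x.1.ofLp y.1.ofLp := rfl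

theorem antisymForm_antisymAction [DecidableEq n] (e : Fin k ⊕ Fin k ≃ n) (g : Matrix n n 𝕜)
    (x y : antisymTensor 𝕜 k n) :
    antisymForm e (antisymAction k g x) (antisymAction k g y) = g.det * antisymForm e x y := by
  simp only [antisymForm_apply, coe_antisymAction, Matrix.ofLp_toEuclideanCLM,
    wedgeForm_tensorPow_mulVec]

theorem exists_antilipschitzWith_of_separatingLeft {H : Type*} [NormedAddCommGroup H]
    [NormedSpace 𝕜 H] [FiniteDimensional 𝕜 H] {ω : H →L[𝕜] H →L[𝕜] 𝕜}
    (h : ∀ w ≠ 0, ∃ x, ω w x ≠ 0) : ∃ κ, AntilipschitzWith κ ω := by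
  have hker : LinearMap.ker ω.toLinearMap = ⊥ := by
    refine LinearMap.ker_eq_bot'.2 fun w hw => by_contra fun h0 => ?_
    obtain ⟨x, hx⟩ := h w h0
    exact hx (DFunLike.congr_fun hw x)
  obtain ⟨κ, -, hκ⟩ := ω.toLinearMap.exists_antilipschitzWith hker
  exact ⟨κ, hκ⟩

theorem exists_antilipschitzWith_antisymForm (e : Fin k ⊕ Fin k ≃ n) :
    ∃ κ, AntilipschitzWith κ (antisymForm (𝕜 := 𝕜) e) := by
  refine exists_antilipschitzWith_of_separatingLeft fun w hw => ?_
  obtain ⟨x, hx⟩ := exists_wedgeForm_ne_zero e hw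
  rw [wedgeForm_comm] at hx
  exact ⟨x, right_ne_zero_of_mul hx⟩

end WedgeForm

section SingularValues

open Module Matrix

section OrderedProducts

variable {R : Type*} [CommSemiring R] [PartialOrder R] [IsOrderedRing R] {σ : ℕ → R} {d k : ℕ}

theorem prod_le_prod_range_card (hσ : Antitone σ) (h0 : ∀ m, 0 ≤ σ m) (F : Finset ℕ) :
    ∏ m ∈ F, σ m ≤ ∏ m ∈ Finset.range F.card, σ m := by
  induction F using Finset.induction_on_max with
  | empty => simp
  | insert M F hM ih =>
    have hMF : M ∉ F := fun h => lt_irrefl _ (hM M h)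
    have hcard : F.card ≤ M := by
      simpa using Finset.card_le_card (t := Finset.range M) fun m hm => by simpa using hM m hm
    rw [Finset.prod_insert hMF, Finset.card_insert_of_notMem hMF, Finset.prod_range_succ, mul_comm]
    exact mul_le_mul ih (hσ hcard) (h0 _) (Finset.prod_nonneg fun m _ => h0 m)

theorem prod_le_of_ne_range (hσ : Antitone σ) (h0 : ∀ m, 0 ≤ σ m) {F : Finset ℕ}
    (hF : F.card = k + 1) (hne : F ≠ Finset.range (k + 1)) :
    ∏ m ∈ F, σ m ≤ (∏ m ∈ Finset.range k, σ m) * σ (k + 1) := by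
  obtain ⟨M, hMF, hM⟩ : ∃ M ∈ F, k + 1 ≤ M := by
    by_contra! h
    exact hne (Finset.eq_of_subset_of_card_le (fun m hm => Finset.mem_range.2 (h m hm))
      (by simp [hF]))
  have herase := prod_le_prod_range_card hσ h0 (F.erase M)
  rw [Finset.card_erase_of_mem hMF, hF, Nat.add_sub_cancel] at herase
  rw [← Finset.mul_prod_erase F σ hMF, mul_comm]
  exact mul_le_mul herase (hσ hM) (h0 _) (Finset.prod_nonneg fun m _ => h0 m)

theorem prod_comp_le (hσ : Antitone σ) (h0 : ∀ m, 0 ≤ σ m) {i : Fin k → Fin d}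
    (hi : Function.Injective i) : ∏ a, σ (i a) ≤ ∏ m ∈ Finset.range k, σ m := by
  have hinj : Function.Injective fun a => (i a : ℕ) := Fin.val_injective.comp hi
  have h := prod_le_prod_range_card hσ h0 (Finset.univ.image fun a => (i a : ℕ))
  rwa [Finset.prod_image hinj.injOn, Finset.card_image_of_injective _ hinj, Finset.card_univ,
    Fintype.card_fin] at h

theorem prod_comp_le_of_ne (hσ : Antitone σ) (h0 : ∀ m, 0 ≤ σ m) (hk : k + 1 ≤ d)
    {i : Fin (k + 1) → Fin d} (hi : Function.Injective i)
    (hne : ∀ τ : Equiv.Perm (Fin (k + 1)), i ≠ Fin.castLE hk ∘ τ) :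
    ∏ a, σ (i a) ≤ (∏ m ∈ Finset.range k, σ m) * σ (k + 1) := by
  have hinj : Function.Injective fun a => (i a : ℕ) := Fin.val_injective.comp hi
  rw [← Finset.prod_image (s := Finset.univ) (f := σ) hinj.injOn]
  refine prod_le_of_ne_range hσ h0 (by simp [Finset.card_image_of_injective _ hinj]) fun h => ?_
  have hlt (a) : (i a : ℕ) < k + 1 := by
    rw [← Finset.mem_range, ← h]
    exact Finset.mem_image_of_mem _ (Finset.mem_univ a)
  let f : Fin (k + 1) → Fin (k + 1) := fun a => ⟨i a, hlt a⟩
  have hf : Function.Injective f := fun a b hab => hinj (Fin.mk.inj_iff.1 hab)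
  exact hne (Equiv.ofBijective f (Finite.injective_iff_bijective.1 hf)) rfl

end OrderedProducts

variable {𝕜 : Type*} [RCLike 𝕜]

section Gram

variable {n : Type*} [Fintype n] [DecidableEq n] {k : ℕ} {M : Matrix n n 𝕜} {σ : n → ℝ}

theorem norm_sq_toEuclideanCLM_of_gram (h : Mᴴ * M = diagonal fun i => (σ i : 𝕜) ^ 2)
    (y : EuclideanSpace 𝕜 n) :
    ‖toEuclideanCLM (𝕜 := 𝕜) M y‖ ^ 2 = ∑ i, (σ i * ‖y i‖) ^ 2 := by
  have hinner : inner 𝕜 (toEuclideanCLM (𝕜 := 𝕜) M y) (toEuclideanCLM (𝕜 := 𝕜) M y) =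
      inner 𝕜 y (toEuclideanCLM (𝕜 := 𝕜) (Mᴴ * M) y) := by
    rw [map_mul, mul_apply_eq_comp, ← star_eq_conjTranspose, map_star,
      ContinuousLinearMap.star_eq_adjoint, ContinuousLinearMap.adjoint_inner_right]
  rw [inner_self_eq_norm_sq_to_K, h, PiLp.inner_apply] at hinner
  have hcast : ((‖toEuclideanCLM (𝕜 := 𝕜) M y‖ ^ 2 : ℝ) : 𝕜) =
      ((∑ i, (σ i * ‖y i‖) ^ 2 : ℝ) : 𝕜) := by
    push_cast
    refine hinner.trans (Finset.sum_congr rfl fun i _ => ?_)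
    rw [ofLp_toEuclideanCLM, mulVec_diagonal, RCLike.inner_apply, mul_assoc, RCLike.mul_conj,
      mul_pow]
  exact_mod_cast hcast

theorem norm_sq_antisymAction_of_gram (h : Mᴴ * M = diagonal fun i => (σ i : 𝕜) ^ 2)
    (y : antisymTensor 𝕜 k n) :
    ‖antisymAction k M y‖ ^ 2 = ∑ i, ((∏ a, σ (i a)) * ‖y.1 i‖) ^ 2 := by
  rw [Submodule.coe_norm, coe_antisymAction]
  refine norm_sq_toEuclideanCLM_of_gram ?_ _
  rw [← tensorPow_conjTranspose, ← tensorPow_mul, h, tensorPow_diagonal]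
  simp only [Finset.prod_pow, RCLike.ofReal_prod]

theorem norm_antisymAction_le_of_gram (h : Mᴴ * M = diagonal fun i => (σ i : 𝕜) ^ 2)
    (hσ : ∀ i, 0 ≤ σ i) {y z : antisymTensor 𝕜 k n} {r : ℝ} (hr : 0 ≤ r)
    (hyz : ∀ i, (∏ a, σ (i a)) * ‖y.1 i‖ ≤ r * ‖z.1 i‖) : ‖antisymAction k M y‖ ≤ r * ‖z‖ := by
  rw [← sq_le_sq₀ (norm_nonneg _) (by positivity), norm_sq_antisymAction_of_gram h, mul_pow,
    Submodule.coe_norm, EuclideanSpace.norm_sq_eq, Finset.mul_sum]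
  refine Finset.sum_le_sum fun i _ => ?_
  rw [← mul_pow]
  exact pow_le_pow_left₀ (mul_nonneg (Finset.prod_nonneg fun a _ => hσ (i a)) (norm_nonneg _))
    (hyz i) 2

theorem norm_antisymAction_le_one (h : Mᴴ * M = 1) : ‖antisymAction k M‖ ≤ 1 := by
  refine ContinuousLinearMap.opNorm_le_bound _ zero_le_one fun y => ?_
  exact norm_antisymAction_le_of_gram (σ := 1) (by simpa using h) (by simp) zero_le_one (by simp)

end Gram

variable {d k : ℕ} {M : Matrix (Fin d) (Fin d) 𝕜} {σ : ℕ → ℝ}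

theorem norm_antisymAction_le_prod (h : Mᴴ * M = diagonal fun i : Fin d => (σ i : 𝕜) ^ 2)
    (hσ : Antitone σ) (h0 : ∀ m, 0 ≤ σ m) (y : antisymTensor 𝕜 k (Fin d)) :
    ‖antisymAction k M y‖ ≤ (∏ m ∈ Finset.range k, σ m) * ‖y‖ := by
  refine norm_antisymAction_le_of_gram h (fun i => h0 i) (Finset.prod_nonneg fun m _ => h0 m)
    fun i => ?_
  by_cases hi : Function.Injective i
  · gcongr
    exact prod_comp_le hσ h0 hi
  · simp [antisymTensor_apply_eq_zero y hi]

theorem norm_antisymAction_antisymSingle_castLE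
    (h : Mᴴ * M = diagonal fun i : Fin d => (σ i : 𝕜) ^ 2) (h0 : ∀ m, 0 ≤ σ m) (hk : k ≤ d) :
    ‖antisymAction k M (antisymSingle (Fin.castLE hk))‖ =
      (∏ m ∈ Finset.range k, σ m) * ‖antisymSingle (𝕜 := 𝕜) (Fin.castLE hk)‖ := by
  have hs : 0 ≤ ∏ m ∈ Finset.range k, σ m := Finset.prod_nonneg fun m _ => h0 m
  rw [← sq_eq_sq₀ (norm_nonneg _) (by positivity), norm_sq_antisymAction_of_gram h, mul_pow,
    Submodule.coe_norm, EuclideanSpace.norm_sq_eq, Finset.mul_sum]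
  refine Finset.sum_congr rfl fun i _ => ?_
  rw [mul_pow]
  by_cases hi : ∃ τ : Equiv.Perm (Fin k), i = Fin.castLE hk ∘ τ
  · obtain ⟨τ, rfl⟩ := hi
    simp only [Function.comp]
    rw [Equiv.prod_comp τ fun a => σ (Fin.castLE hk a), Finset.prod_range]
    rfl
  · push Not at hi
    simp [antisymSingle_apply_eq_zero hi]

theorem norm_antisymAction_sub_smul_antisymSingle_le
    (h : Mᴴ * M = diagonal fun i : Fin d => (σ i : 𝕜) ^ 2) (hσ : Antitone σ) (h0 : ∀ m, 0 ≤ σ m)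
    (hk : k + 1 ≤ d) (y : antisymTensor 𝕜 (k + 1) (Fin d)) :
    ‖antisymAction (k + 1) M (y - y.1 (Fin.castLE hk) • antisymSingle (Fin.castLE hk))‖ ≤
      (∏ m ∈ Finset.range k, σ m) * σ (k + 1) * ‖y‖ := by
  set z := y - y.1 (Fin.castLE hk) • antisymSingle (Fin.castLE hk) with hz
  have hzero : z.1 (Fin.castLE hk) = 0 := by
    simp [hz, antisymSingle_apply_self (Fin.castLE_injective hk)]
  have hr : 0 ≤ (∏ m ∈ Finset.range k, σ m) * σ (k + 1) :=
    mul_nonneg (Finset.prod_nonneg fun m _ => h0 m) (h0 _)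
  refine norm_antisymAction_le_of_gram h (fun i => h0 i) hr fun i => ?_
  by_cases hi : ∃ τ : Equiv.Perm (Fin (k + 1)), i = Fin.castLE hk ∘ τ
  · obtain ⟨τ, rfl⟩ := hi
    rw [antisymTensor_apply_comp, hzero, mul_zero, norm_zero, mul_zero]
    positivity
  push Not at hi
  by_cases hinj : Function.Injective i
  · have hzi : z.1 i = y.1 i := by simp [hz, antisymSingle_apply_eq_zero hi]
    rw [hzi]
    gcongr
    exact prod_comp_le_of_ne hσ h0 hk hinj hi
  · simp [antisymTensor_apply_eq_zero _ hinj]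

theorem exists_unitary_gram_eq_diagonal (g : Matrix (Fin d) (Fin d) 𝕜) :
    ∃ V : Matrix (Fin d) (Fin d) 𝕜, Vᴴ * V = 1 ∧ (g * V)ᴴ * (g * V) =
      diagonal fun i : Fin d => (((toEuclideanLin g).singularValues i : ℝ) : 𝕜) ^ 2 := by
  set T := toEuclideanLin g with hT
  have hd : finrank 𝕜 (EuclideanSpace 𝕜 (Fin d)) = d := by simp
  set e := T.isSymmetric_adjoint_comp_self.eigenvectorBasis hd with he
  have hgram (w : Fin d → EuclideanSpace 𝕜 (Fin d)) (i j : Fin d) :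
      ((of fun a i => w i a)ᴴ * (of fun a i => w i a)) i j = inner 𝕜 (w i) (w j) := by
    rw [mul_apply, PiLp.inner_apply]
    simp [mul_comm]
  have hgV : g * (of fun a i => e i a) = of fun a i => T (e i) a := by
    ext a i
    simp [hT, mul_apply, toLpLin_apply, mulVec, dotProduct]
  refine ⟨of fun a i => e i a, ?_, ?_⟩ <;> ext i j
  · rw [hgram, e.inner_eq_ite, one_apply]
  · rw [hgV, hgram, ← LinearMap.adjoint_inner_right, ← LinearMap.comp_apply, he,
      LinearMap.IsSymmetric.apply_eigenvectorBasis, inner_smul_right, ← he, e.inner_eq_ite,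
      ← T.sq_singularValues_fin hd, diagonal_apply]
    split_ifs with h
    · subst h; simp
    · simp

theorem singularValues_pos_of_det_ne_zero {g : Matrix (Fin d) (Fin d) 𝕜} (hg : g.det ≠ 0) {m : ℕ}
    (hm : m < d) : 0 < (toEuclideanLin g).singularValues m := by
  refine (toEuclideanLin g).injective_iff_forall_lt_finrank_singularValues_pos.1 ?_ m
    (by simpa using hm)
  rw [← LinearMap.ker_eq_bot, LinearMap.ker_eq_bot']
  intro x hx
  exact PiLp.ext (congrFun (eq_zero_of_mulVec_eq_zero hg (congrArg WithLp.ofLp hx)))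

theorem exists_isDominated_antisymAction (hk : k + 1 ≤ d) {g : Matrix (Fin d) (Fin d) 𝕜}
    (hg : g.det ≠ 0) : ∃ u,
    IsDominated (𝕜 := 𝕜) (H := antisymTensor 𝕜 (k + 1) (Fin d)) (antisymAction (k + 1) g) u
      ((toEuclideanLin g).singularValues (k + 1) / (toEuclideanLin g).singularValues k) := by
  set σ : ℕ → ℝ := ⇑(toEuclideanLin g).singularValues
  have hσ : Antitone σ := (toEuclideanLin g).singularValues_antitone
  have h0 (m) : 0 ≤ σ m := (toEuclideanLin g).singularValues_nonneg m
  have hpos {m} (hm : m < d) : 0 < σ m := singularValues_pos_of_det_ne_zero hg hm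
  obtain ⟨V, hV, hgV⟩ := exists_unitary_gram_eq_diagonal g
  have hV' : V * Vᴴ = 1 := mul_eq_one_comm.1 hV
  have hx : antisymSingle (𝕜 := 𝕜) (Fin.castLE hk) ≠ 0 := fun h => by
    have := antisymSingle_apply_self (𝕜 := 𝕜) (Fin.castLE_injective hk)
    simp [h] at this
  have hratio : (∏ m ∈ Finset.range k, σ m) * σ (k + 1) =
      σ (k + 1) / σ k * ∏ m ∈ Finset.range (k + 1), σ m := by
    rw [Finset.prod_range_succ, div_mul_eq_mul_div, eq_div_iff (hpos hk).ne']
    ring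
  have hdom := IsDominated.of_norm_apply_eq (𝕜 := 𝕜) (H := antisymTensor 𝕜 (k + 1) (Fin d))
    (Finset.prod_pos fun m hm => hpos ((Finset.mem_range.1 hm).trans_le hk)) hx
    (norm_antisymAction_antisymSingle_castLE hgV h0 hk) (norm_antisymAction_le_prod hgV hσ h0)
    fun y => ⟨_, hratio ▸ norm_antisymAction_sub_smul_antisymSingle_le hgV hσ h0 hk y⟩
  rw [antisymAction_mul] at hdom
  exact ⟨_, hdom.of_mul (norm_antisymAction_le_one hV)
    (norm_antisymAction_le_one (M := Vᴴ) (by rwa [conjTranspose_conjTranspose]))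
    (by rw [← antisymAction_mul, hV', antisymAction_one])⟩

end SingularValues

section Anosov

variable {Γ : Type*} [Group Γ] {S : Set Γ} {k d : ℕ}

/-- The action of `Γ` through `ρ` on the antisymmetric tensors in `(ℂ^d)^⊗k`, a model of the
exterior power `Λ^k ρ`. -/
noncomputable def antisymRep (k : ℕ) (ρ : Γ →* Matrix.SpecialLinearGroup (Fin d) ℂ) :
    Γ →* (antisymTensor ℂ k (Fin d) →L[ℂ] antisymTensor ℂ k (Fin d)) where
  toFun γ := antisymAction k (ρ γ).1
  map_one' := by
    rw [map_one]
    exact antisymAction_one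
  map_mul' a b := by
    rw [map_mul, Matrix.SpecialLinearGroup.coe_mul]
    exact antisymAction_mul _ _

theorem antisymForm_antisymRep (e : Fin k ⊕ Fin k ≃ Fin d)
    (ρ : Γ →* Matrix.SpecialLinearGroup (Fin d) ℂ) (γ : Γ) (x y : antisymTensor ℂ k (Fin d)) :
    antisymForm e (antisymRep k ρ γ x) (antisymRep k ρ γ y) = antisymForm e x y :=
  (antisymForm_antisymAction e _ x y).trans (by rw [(ρ γ).2, one_mul])

theorem antisymForm_neg_comm (hk : Odd k) (e : Fin k ⊕ Fin k ≃ Fin d)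
    (x y : antisymTensor ℂ k (Fin d)) : antisymForm e x y = -antisymForm e y x := by
  rw [antisymForm_apply, wedgeForm_comm, hk.neg_one_pow, neg_one_mul, antisymForm_apply]

theorem IsAnosov.exists_isUniformlyDominated_antisymRep (hΓ : IsWordHyperbolic S)
    {ρ : Γ →* Matrix.SpecialLinearGroup (Fin d) ℂ} (hρ : IsAnosov S k ρ) :
    ∃ u C θ K, IsUniformlyDominated (𝕜 := ℂ) (H := antisymTensor ℂ k (Fin d)) S
      (antisymRep k ρ) u C θ K := by
  obtain ⟨hk, hkd, c, μ, hc, hμ, hgap⟩ := hρ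
  obtain ⟨k, rfl⟩ := Nat.exists_eq_add_of_le' hk
  have hratio (γ : Γ) : sigma (k + 2) (ρ γ).1 / sigma (k + 1) (ρ γ).1 ≤
      c⁻¹ * Real.exp (-μ) ^ wordLength S γ := by
    calc sigma (k + 2) (ρ γ).1 / sigma (k + 1) (ρ γ).1
        = (sigma (k + 1) (ρ γ).1 / sigma (k + 2) (ρ γ).1)⁻¹ := (inv_div _ _).symm
      _ ≤ (c * Real.exp (μ * wordLength S γ))⁻¹ := inv_anti₀ (by positivity) (hgap γ)
      _ = c⁻¹ * Real.exp (-μ) ^ wordLength S γ := by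
        rw [mul_inv, ← Real.exp_neg, ← Real.exp_nat_mul]
        ring_nf
  choose u hu using fun γ => exists_isDominated_antisymAction (k := k) (by omega)
    (g := (ρ γ).1) (by simp)
  obtain ⟨K, hK, hnorm⟩ := exists_norm_map_le_pow_wordLength (𝕜 := ℂ)
    (H := antisymTensor ℂ (k + 1) (Fin d)) hΓ.finite hΓ.closure_eq_top (antisymRep (k + 1) ρ)
  exact ⟨u, c⁻¹, Real.exp (-μ), K, Real.exp_pos _, by simpa using hμ,
    fun γ => (hu γ).mono (hratio γ), hK, hnorm⟩

end Anosov

theorem corollary1p4_general {Γ : Type*} [Group Γ] {S : Set Γ} (hΓ : IsWordHyperbolic S)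
    {f : Metric.sphere (0 : EuclideanSpace ℝ (Fin 3)) 1 → GromovBoundary S} (hf : Continuous f)
    (hrange : Set.range f ≠ Set.univ) {k d : ℕ} (hk : Odd k) (hd : d = 2 * k)
    {ρ : Γ →* Matrix.SpecialLinearGroup (Fin d) ℂ} (hρ : IsAnosov S k ρ) :
    ∃ x, f (-x) = f x := by
  let e : Fin k ⊕ Fin k ≃ Fin d := finSumFinEquiv.trans (finCongr (by omega))
  obtain ⟨u, C, θ, K, hdom⟩ := hρ.exists_isUniformlyDominated_antisymRep hΓ
  obtain ⟨κ, hκ⟩ := exists_antilipschitzWith_antisymForm (𝕜 := ℂ) e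
  obtain ⟨v, hv, htrans⟩ := hdom.exists_transverse_boundaryMap hΓ (antisymForm_antisymRep e ρ) hκ
  exact exists_apply_neg_eq_of_transverse_lines hv (antisymForm_neg_comm hk e) htrans hf hrange

theorem corollary1p4 {Γ : Type*} [Group Γ] (S : Set Γ) (hΓ : IsWordHyperbolic S)
    (hS2 : ProperlyContainsTwoSphere (GromovBoundary S)) (q : ℕ) :
    ¬ ∃ ρ : Γ →* Matrix.SpecialLinearGroup (Fin (4 * q + 2)) ℂ, IsAnosov S (2 * q + 1) ρ := by
  rintro ⟨ρ, hρ⟩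
  obtain ⟨f, hf, hrange⟩ := hS2
  obtain ⟨x, hx⟩ := corollary1p4_general hΓ hf.continuous hrange (odd_two_mul_add_one q)
    (by ring) hρ
  exact ne_neg_of_mem_unit_sphere ℝ x (hf.injective hx).symm
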